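/- A partition of a non-negative integer $n$ is a finite non-increasing sequence of positive integers with sum $n$ (the empty sequence for $n=0$). The hook number of a dot in its Ferrers--Young diagram is the number of dots directly to the right of it in its row plus the number directly below it in its column, plus one for the dot itself. A partition is a $t$-core if none of its hook numbers is divisible by $t$. Let $A_{t,k}(n)$ denote the number of ordered $k$-tuples $(\Lambda_1,\dots,\Lambda_k)$ of $t$-core partitions whose sizes add up to $n$. Then for all integers $i\ge 0$ and $n\ge 0$ we have \begin{align*} A_{5,25i+2}(25n+23)&\equiv 0 \pmod{5},\\ A_{5,125i+2}(25n+23)&\equiv 0 \pmod{25},\\ A_{5,3125i+2}(125n+123)&\equiv 0 \pmod{125},\\ A_{5,25i+3}(25n+22)&\equiv 0 \pmod{5},\\ A_{5,625i+3}(125n+122)&\equiv 0 \pmod{25},\\ A_{5,5i+4}(5n+3)&\equiv 0 \pmod{5},\\ A_{5,5i+4}(5n+4)&\equiv 0 \pmod{5},\\ A_{5,25i+4}(25n+21)&\equiv 0 \pmod{5},\\ A_{5,125i+4}(25n+21)&\equiv 0 \pmod{25},\\ A_{5,625i+4}(25n+21)&\equiv 0 \pmod{125},\\ A_{5,3125i+4}(25n+21)&\equiv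 0 \pmod{625},\\ A_{5,15625i+4}(25n+21)&\equiv 0 \pmod{3125},\\ A_{5,390625i+4}(125n+121)&\equiv 0 \pmod{15625}. \end{align*} -/

import Mathlib

/-- The hook number of the dot in row `i` and column `j` of the Ferrers-Young diagram `μ`: the
number of dots strictly to its right, plus the number of dots strictly below it, plus one for the
dot itself. It is only used for dots `(i, j) ∈ μ`. -/
def YoungDiagram.hookNumber (μ : YoungDiagram) (i j : ℕ) : ℕ :=
  (μ.rowLen i - (j + 1)) + (μ.colLen j - (i + 1)) + 1

/-- A partition, given by its Ferrers-Young diagram, is a `t`-core if none of its hook numbers is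
divisible by `t`. -/
def YoungDiagram.IsTCore (t : ℕ) (μ : YoungDiagram) : Prop :=
  ∀ i j : ℕ, (i, j) ∈ μ → ¬ t ∣ μ.hookNumber i j

/-- The `k`-tuples of `t`-core partitions (as Ferrers-Young diagrams, possibly empty) whose sizes
add up to `n`. -/
def coreTuples (t k n : ℕ) : Set (Fin k → YoungDiagram) :=
  {Λ | (∀ m, (Λ m).IsTCore t) ∧ ∑ m, (Λ m).card = n}

/-- There are only finitely many such tuples, so that counting them by `Set.ncard` is meaningful. -/
theorem coreTuples_finite (t k n : ℕ) : (coreTuples t k n).Finite := by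
  have h1 : {μ : YoungDiagram | μ.card ≤ n}.Finite := by
    refine Set.Finite.of_finite_image (f := YoungDiagram.cells)
      (((Finset.range n ×ˢ Finset.range n).powerset.finite_toSet).subset ?_)
      (fun μ _ ν _ h => YoungDiagram.ext h)
    rintro _ ⟨μ, hμ, rfl⟩
    simp only [Finset.coe_powerset, Set.mem_preimage, Set.mem_powerset_iff, Finset.coe_subset]
    rintro ⟨i, j⟩ hc
    have hμ' : μ.cells.card ≤ n := hμ
    have hi : i < μ.colLen j := YoungDiagram.mem_iff_lt_colLen.1 hc
    have hj : j < μ.rowLen i := YoungDiagram.mem_iff_lt_rowLen.1 hc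
    have hci : μ.colLen j ≤ μ.cells.card := by
      rw [YoungDiagram.colLen_eq_card]; exact Finset.card_filter_le _ _
    have hrj : μ.rowLen i ≤ μ.cells.card := by
      rw [YoungDiagram.rowLen_eq_card]; exact Finset.card_filter_le _ _
    simp only [Finset.mem_product, Finset.mem_range]
    omega
  refine (Set.Finite.pi' (fun _ : Fin k => h1)).subset ?_
  rintro Λ ⟨-, hs⟩ m
  have : (Λ m).card ≤ ∑ m, (Λ m).card :=
    Finset.single_le_sum (f := fun m => (Λ m).card) (fun _ _ => Nat.zero_le _) (Finset.mem_univ m)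
  exact this.trans hs.le

/-- `A_{t,k}(n)`: the number of partition `k`-tuples of `n` with `t`-cores. -/
noncomputable def coreTupleCount (t k n : ℕ) : ℕ :=
  (coreTuples t k n).ncard

/-!
The generating series of the `5`-cores is `∏ (1 - X ^ (5 n)) ^ 5 / (1 - X ^ n)`, so that
`A_{5,k}(n)` is a coefficient of its `k`-th power. The congruences for `k = 2, 3, 4` come from the
action of `U : ∑ a n X ^ n ↦ ∑ a (5 n) X ^ n` on the `k`-th power of `F = X ∏ (1 - X ^ (5 n)) ^ 5 /
(1 - X ^ n)`, and those for larger tuples follow from the Frobenius endomorphism.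

*Cores.* The beta-set of a diagram padded to `N` rows determines the diagram, and the diagram is a
`t`-core exactly if its beta-set is closed under subtraction of `t`
(`YoungDiagram.isTCore_iff_betaSet`). Such sets are given by the numbers `c r` of their elements in
the residue classes modulo `t`, so `t`-cores are counted by tuples `c` of sum `N` and prescribed
weight (`coreCount_eq_ncard`). The same tuples occur when the factors of `∏ (1 + z q ^ i)` in the
`q`-binomial theorem are sorted by `i` modulo `t` (`qBinom_mul_eq_sum`). As the number of factors
and `N` grow, the Gaussian binomials tend to inverse Euler products, which gives the generating
series (`coreSeries_mul_pentagonalSeries`) without the Jacobi triple product.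

*The modular equation.* Let `E = ∏ (1 - X ^ n)`, and let `y` be `X ∏ (1 - X ^ (25 n))`. By the
pentagonal number theorem `E = x - y - z`, where `x` and `z` are supported on the exponents
congruent to `0` and `2` modulo `5`. The cube of `E` has no exponents congruent to `2` modulo `5`,
since by Jacobi's identity its exponents are triangular numbers; this says that `x z = y ^ 2`
(`exists_dissection`). The product of `E (ω ^ j X)` over the fifth roots of unity is computed from
the factorization of `E` and from its dissection (`dissection_norm`). Elimination of `x` and `z`
yields a polynomial relation between `E`, `y` and `E (X ^ 5)` (`quintic`).

*The action of `U`.* Put `H = ∏ (1 - X ^ n) ^ 5 / (1 - X ^ (5 n))`. The dissection gives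
`U (F ^ j H)` for `1 ≤ j ≤ 4`, and the modular equation, rewritten in terms of `F`, `H` and their
values at `X ^ 5` (`expand_eisH_pow_five`), turns into recurrences which determine `U (F ^ j H ^ i)`
for the other exponents. On forms of degree `k` in `F` and `H` the operator acts by an explicit integer matrix,
and applying it two or three times to `F ^ k` produces the powers of `5` in the theorem.

*Larger tuples.* For `G` with integer coefficients `G ^ (5 ^ (b + c))` is congruent to a series in
`X ^ (5 ^ b)` modulo `5 ^ (c + 1)`, so congruences on residue classes modulo `5 ^ b` for the
coefficients of `G ^ k` pass to `G ^ (5 ^ (b + c) i + k)` (`five_pow_dvd_coeff_pow`). The same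
congruence modulo `5` shows that the fourth power of the generating series is `E` times a series in
`X ^ 5`, which settles the exponents `5 n + 3` and `5 n + 4`.
-/

open PowerSeries

/-! ### Gaussian binomial coefficients -/

/-- The Gaussian binomial coefficient `[m; k]` evaluated at an element `q` of a commutative ring,
defined by the `q`-Pascal recursion `[m + 1; k + 1] = [m; k] + q ^ (k + 1) [m; k + 1]`. -/
def qBinom {R : Type*} [CommRing R] (q : R) : ℕ → ℕ → R
  | _, 0 => 1
  | 0, _ + 1 => 0
  | m + 1, k + 1 => qBinom q m k + q ^ (k + 1) * qBinom q m (k + 1)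

/-- The finite Euler product `(1 - q) (1 - q ^ 2) ⋯ (1 - q ^ k)`. -/
def qFact {R : Type*} [CommRing R] (q : R) (k : ℕ) : R :=
  ∏ i ∈ Finset.range k, (1 - q ^ (i + 1))

section QBinomial

variable {R S : Type*} [CommRing R] [CommRing S]

@[simp]
theorem qBinom_zero_right (q : R) (m : ℕ) : qBinom q m 0 = 1 := by
  cases m <;> rfl

theorem qBinom_succ_succ (q : R) (m k : ℕ) :
    qBinom q (m + 1) (k + 1) = qBinom q m k + q ^ (k + 1) * qBinom q m (k + 1) := rfl

theorem qBinom_eq_zero (q : R) {m k : ℕ} (h : m < k) : qBinom q m k = 0 := by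
  induction m generalizing k with
  | zero => obtain ⟨k, rfl⟩ := Nat.exists_eq_add_one_of_ne_zero h.ne'; rfl
  | succ m ih =>
    obtain ⟨k, rfl⟩ := Nat.exists_eq_add_one_of_ne_zero (Nat.ne_zero_of_lt h)
    rw [qBinom_succ_succ, ih (by omega), ih (by omega)]; simp

theorem map_qBinom (f : R →+* S) (q : R) (m k : ℕ) : f (qBinom q m k) = qBinom (f q) m k := by
  induction m generalizing k with
  | zero => cases k <;> simp [qBinom]
  | succ m ih => cases k <;> simp [qBinom_succ_succ, ih]

theorem map_qFact (f : R →+* S) (q : R) (k : ℕ) : f (qFact q k) = qFact (f q) k := by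
  simp [qFact]

@[simp]
theorem qFact_zero (q : R) : qFact q 0 = 1 := by simp [qFact]

theorem qFact_succ (q : R) (k : ℕ) : qFact q (k + 1) = qFact q k * (1 - q ^ (k + 1)) := by
  simp [qFact, Finset.prod_range_succ]

theorem qBinom_mul_qFact (q : R) (k l : ℕ) :
    qBinom q (k + l) k * (qFact q k * qFact q l) = qFact q (k + l) := by
  suffices ∀ n k l, k + l = n → qBinom q (k + l) k * (qFact q k * qFact q l) = qFact q (k + l) from
    this _ k l rfl
  intro n
  induction n with
  | zero => intro k l h; obtain ⟨rfl, rfl⟩ : k = 0 ∧ l = 0 := by omega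
            simp
  | succ n ih =>
    rintro (_ | k) (_ | l) h
    · simp
    · simp
    · have h1 := ih k 0 (by omega)
      simp only [Nat.add_zero, qFact_zero, mul_one] at h1 ⊢
      rw [qBinom_succ_succ, qBinom_eq_zero q (Nat.lt_succ_self k), qFact_succ]
      linear_combination (1 - q ^ (k + 1)) * h1
    · have h1 := ih k (l + 1) (by omega)
      have h2 := ih (k + 1) l (by omega)
      rw [show k + 1 + (l + 1) = (k + (l + 1)) + 1 by ring, qBinom_succ_succ,
        qFact_succ q (k + (l + 1))]
      rw [show k + 1 + l = k + (l + 1) by ring] at h2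
      rw [qFact_succ q l] at h1 ⊢
      rw [qFact_succ q k] at h2 ⊢
      linear_combination (1 - q ^ (k + 1)) * h1 + q ^ (k + 1) * (1 - q ^ (l + 1)) * h2

/-- The homogeneous `q`-binomial theorem. -/
theorem prod_add_mul_pow (q a z : R) (m : ℕ) :
    ∏ i ∈ Finset.range m, (a + z * q ^ i) =
      ∑ k ∈ Finset.range (m + 1), q ^ (k.choose 2) * qBinom q m k * (z ^ k * a ^ (m - k)) := by
  induction m generalizing z with
  | zero => simp
  | succ m ih =>
    have h1 : ∏ i ∈ Finset.range m, (a + z * q ^ (i + 1)) =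
        ∏ i ∈ Finset.range m, (a + z * q * q ^ i) :=
      Finset.prod_congr rfl fun i _ => by ring
    rw [Finset.prod_range_succ', h1, ih, Finset.sum_range_succ' _ (m + 1)]
    have h2 : ∀ k, q ^ ((k + 1).choose 2) * qBinom q (m + 1) (k + 1) *
          (z ^ (k + 1) * a ^ (m + 1 - (k + 1))) =
        z * (q ^ (k.choose 2) * qBinom q m k * ((z * q) ^ k * a ^ (m - k))) +
          q ^ ((k + 1).choose 2) * qBinom q m (k + 1) * ((z * q) ^ (k + 1) * a ^ (m - k)) := by
      intro k
      rw [qBinom_succ_succ, show (k + 1).choose 2 = k.choose 2 + k by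
        rw [Nat.choose_succ_succ' k 1]; simp [add_comm], Nat.add_sub_add_right]
      ring
    have h3 : ∑ k ∈ Finset.range (m + 1),
          q ^ ((k + 1).choose 2) * qBinom q m (k + 1) * ((z * q) ^ (k + 1) * a ^ (m - k)) =
        a * ∑ k ∈ Finset.range m, q ^ ((k + 1).choose 2) * qBinom q m (k + 1) *
          ((z * q) ^ (k + 1) * a ^ (m - (k + 1))) := by
      rw [Finset.sum_range_succ, qBinom_eq_zero q (Nat.lt_succ_self m), Finset.mul_sum]
      simp only [mul_zero, zero_mul, add_zero]
      refine Finset.sum_congr rfl fun k hk => ?_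
      rw [show m - k = m - (k + 1) + 1 by have := Finset.mem_range.1 hk; omega]
      ring
    simp only [h2, Finset.sum_add_distrib, ← Finset.mul_sum]
    rw [h3]
    have h4 := Finset.sum_range_succ'
      (fun k => q ^ (k.choose 2) * qBinom q m k * ((z * q) ^ k * a ^ (m - k))) m
    simp only [Nat.choose_zero_succ, pow_zero, qBinom_zero_right, one_mul, mul_one,
      Nat.sub_zero] at h4 ⊢
    linear_combination a * h4

/-- The `q`-binomial theorem. -/
theorem prod_one_add_mul_pow (q z : R) (m : ℕ) :
    ∏ i ∈ Finset.range m, (1 + z * q ^ i) =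
      ∑ k ∈ Finset.range (m + 1), q ^ (k.choose 2) * qBinom q m k * z ^ k := by
  simpa using prod_add_mul_pow q 1 z m

theorem coeff_prod_one_add_mul_pow (q a : R) (m k : ℕ) :
    (∏ i ∈ Finset.range m, (1 + Polynomial.X * Polynomial.C (a * q ^ i))).coeff k =
      q ^ (k.choose 2) * qBinom q m k * a ^ k := by
  have h : ∏ i ∈ Finset.range m, (1 + Polynomial.X * Polynomial.C (a * q ^ i)) =
      ∑ j ∈ Finset.range (m + 1),
        Polynomial.C (q ^ (j.choose 2) * qBinom q m j * a ^ j) * Polynomial.X ^ j := by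
    have h := prod_one_add_mul_pow (Polynomial.C q) (Polynomial.X * Polynomial.C a) m
    simp only [mul_assoc, ← map_pow, ← map_mul] at h
    rw [h]
    refine Finset.sum_congr rfl fun j _ => ?_
    rw [← map_qBinom, mul_pow]
    simp only [map_mul, map_pow]
    ring
  rw [h, Polynomial.finsetSum_coeff]
  simp only [Polynomial.coeff_C_mul, Polynomial.coeff_X_pow, mul_ite, mul_one, mul_zero,
    Finset.sum_ite_eq, Finset.mem_range]
  split_ifs with hk
  · rfl
  · rw [qBinom_eq_zero q (by omega)]; simp

/-- Splitting the factors `1 + z q ^ i` with `i < t * L` by the residue of `i` modulo `t` and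
comparing coefficients of `z ^ N`. -/
theorem qBinom_mul_eq_sum (q : R) (t L N : ℕ) :
    q ^ (N.choose 2) * qBinom q (t * L) N =
      ∑ c ∈ (Fintype.piFinset fun _ : Fin t => Finset.range (L + 1)) with ∑ r, c r = N,
        q ^ (∑ r : Fin t, ((r : ℕ) * c r + t * (c r).choose 2)) *
          ∏ r, qBinom (q ^ t) L (c r) := by
  have h1 : ∏ i ∈ Finset.range (t * L), (1 + Polynomial.X * Polynomial.C (1 * q ^ i)) =
      ∏ r : Fin t, ∏ j ∈ Finset.range L,
        (1 + Polynomial.X * Polynomial.C (q ^ (r : ℕ) * (q ^ t) ^ j)) := by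
    rw [Finset.prod_comm]
    induction L with
    | zero => simp
    | succ L ih =>
      rw [Nat.mul_succ, Finset.prod_range_add, ih, Finset.prod_range_succ]
      congr 1
      refine (Finset.prod_range _).trans ?_
      exact Finset.prod_congr rfl fun r _ => by rw [one_mul, ← pow_mul, ← pow_add, add_comm (t * L)]
  have h2 : ∀ r : Fin t, ∏ j ∈ Finset.range L,
        (1 + Polynomial.X * Polynomial.C (q ^ (r : ℕ) * (q ^ t) ^ j)) =
      ∑ k ∈ Finset.range (L + 1), Polynomial.C (q ^ ((r : ℕ) * k + t * k.choose 2) *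
        qBinom (q ^ t) L k) * Polynomial.X ^ k := by
    intro r
    have h := prod_one_add_mul_pow (Polynomial.C (q ^ t))
      (Polynomial.X * Polynomial.C (q ^ (r : ℕ))) L
    simp only [mul_assoc, ← map_pow, ← map_mul] at h
    rw [h]
    refine Finset.sum_congr rfl fun k _ => ?_
    rw [← map_qBinom, mul_pow, pow_add, pow_mul, pow_mul]
    simp only [map_mul, map_pow]
    ring
  have h3 := coeff_prod_one_add_mul_pow q 1 (t * L) N
  rw [one_pow, mul_one] at h3
  rw [← h3, h1, Finset.prod_congr rfl fun r _ => h2 r, Finset.prod_univ_sum,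
    Polynomial.finsetSum_coeff, Finset.sum_filter]
  refine Finset.sum_congr rfl fun c _ => ?_
  rw [Finset.prod_mul_distrib, ← map_prod, Finset.prod_pow_eq_pow_sum, Polynomial.coeff_C_mul,
    Polynomial.coeff_X_pow, Finset.prod_mul_distrib, Finset.prod_pow_eq_pow_sum]
  split_ifs with h h' h'
  · rw [mul_one]
  · exact absurd h.symm h'
  · exact absurd h'.symm h
  · rw [mul_zero]

end QBinomial

/-! ### The Euler product as a limit of finite products -/

section EulerProduct

variable {R : Type*} [CommRing R]

theorem X_pow_dvd_pentagonalSeries_sub_qFact (k : ℕ) :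
    (X : R⟦X⟧) ^ (k + 1) ∣ pentagonalSeries R - qFact X k := by
  rw [X_pow_dvd_iff]
  intro m hm
  obtain ⟨s, hs⟩ := Filter.eventually_atTop.1 (coeff_prod_one_sub_X_pow_eventually_eq R m)
  have h1 := hs (s ∪ Finset.range k) Finset.subset_union_left
  have h2 : ∀ u : Finset ℕ, Disjoint u (Finset.range k) →
      (X : R⟦X⟧) ^ (k + 1) ∣ ∏ i ∈ u, (1 - X ^ (i + 1)) - 1 := by
    intro u
    induction u using Finset.induction_on with
    | empty => simp
    | insert a u ha ih =>
      intro hd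
      rw [Finset.disjoint_insert_left] at hd
      rw [Finset.prod_insert ha]
      have h3 : (X : R⟦X⟧) ^ (k + 1) ∣ X ^ (a + 1) :=
        pow_dvd_pow _ (by have := hd.1; simp at this; omega)
      have := dvd_sub (ih hd.2) (h3.mul_right (∏ i ∈ u, (1 - X ^ (i + 1))))
      convert this using 1
      ring
  have h4 : (X : R⟦X⟧) ^ (k + 1) ∣
      ∏ i ∈ s ∪ Finset.range k, (1 - X ^ (i + 1)) - qFact X k := by
    rw [← Finset.sdiff_union_self_eq_union, Finset.prod_union Finset.sdiff_disjoint]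
    convert (h2 _ Finset.sdiff_disjoint).mul_right (qFact X k) using 1
    rw [sub_mul, one_mul, qFact]
  rw [map_sub, ← h1, ← map_sub]
  exact X_pow_dvd_iff.1 h4 m hm

@[simp]
theorem constantCoeff_pentagonalSeries : constantCoeff (pentagonalSeries R) = 1 := by
  have h := X_pow_dvd_iff.1 (X_pow_dvd_pentagonalSeries_sub_qFact (R := R) 0) 0 (by simp)
  rw [map_sub, sub_eq_zero] at h
  simpa using h

theorem isUnit_pentagonalSeries : IsUnit (pentagonalSeries R) :=
  isUnit_iff_constantCoeff.2 (by simp)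

/-- `[k + l; k]` tends to `1 / ((1 - X) (1 - X ^ 2) ⋯)` as `k` and `l` grow. -/
theorem X_pow_dvd_qBinom_mul_pentagonalSeries_sub_one {k l m : ℕ} (hk : m ≤ k) (hl : m ≤ l) :
    (X : R⟦X⟧) ^ (m + 1) ∣ qBinom X (k + l) k * pentagonalSeries R - 1 := by
  have key : ∀ n, m ≤ n → (X : R⟦X⟧) ^ (m + 1) ∣ pentagonalSeries R - qFact X n := fun n hn =>
    (pow_dvd_pow _ (by omega)).trans (X_pow_dvd_pentagonalSeries_sub_qFact n)
  rw [← (isUnit_pentagonalSeries (R := R)).dvd_mul_left]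
  have h := qBinom_mul_qFact (X : R⟦X⟧) k l
  obtain ⟨a, ha⟩ := key k hk
  obtain ⟨b, hb⟩ := key l hl
  obtain ⟨c, hc⟩ := key (k + l) (by omega)
  rw [sub_eq_iff_eq_add] at ha hb hc
  refine ⟨qBinom X (k + l) k * (a * pentagonalSeries R + qFact X k * b) - c, ?_⟩
  linear_combination h + qBinom X (k + l) k * (pentagonalSeries R * ha + qFact X k * hb) - hc

end EulerProduct

/-! ### Jacobi's identity for the cube of the Euler product -/

section JacobiCube

variable {R : Type*} [CommRing R]

theorem two_mul_choose_two (n : ℕ) : 2 * n.choose 2 = n * (n - 1) := by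
  rw [Nat.choose_two_right, Nat.mul_div_cancel' (Nat.even_mul_pred_self n).two_dvd]

theorem prod_range_pow_sub_pow (q : R) (n : ℕ) :
    ∏ i ∈ Finset.range n, (q ^ n - q ^ i) = (-1) ^ n * q ^ (n.choose 2) * qFact q n := by
  have h : ∀ i ∈ Finset.range n, q ^ n - q ^ i = -1 * q ^ i * (1 - q ^ (n - 1 - i + 1)) := by
    intro i hi
    have hi := Finset.mem_range.1 hi
    have : q ^ n = q ^ i * q ^ (n - 1 - i + 1) := by rw [← pow_add]; congr 1; omega
    rw [this]; ring
  rw [Finset.prod_congr rfl h, Finset.prod_mul_distrib, Finset.prod_mul_distrib,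
    Finset.prod_const, Finset.card_range, Finset.prod_pow_eq_pow_sum, Finset.sum_range_id,
    ← Nat.choose_two_right, Finset.prod_range_reflect (fun i => 1 - q ^ (i + 1)), qFact]

theorem prod_range_pow_sub_pow_add (q : R) (n : ℕ) :
    ∏ i ∈ Finset.range n, (q ^ n - q ^ (n + 1 + i)) = q ^ (n * n) * qFact q n := by
  have h : ∀ i ∈ Finset.range n, q ^ n - q ^ (n + 1 + i) = q ^ n * (1 - q ^ (i + 1)) := by
    intro i _
    ring
  rw [Finset.prod_congr rfl h, Finset.prod_mul_distrib, Finset.prod_const, Finset.card_range,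
    ← pow_mul, qFact]

/-- The derivative at `z = 1` of the finite triple product `∏ i < 2 n + 1, (q ^ n - z q ^ i)`,
computed from its factorization and from the `q`-binomial theorem. -/
theorem sum_qBinom_derivative (q : R) (n : ℕ) :
    ∑ k ∈ Finset.range (2 * n + 1 + 1), q ^ (k.choose 2) * qBinom q (2 * n + 1) k *
        ((-1) ^ k * (q ^ n) ^ (2 * n + 1 - k)) * k =
      (-1) ^ (n + 1) * q ^ (n + n.choose 2 + n * n) * qFact q n ^ 2 := by
  have h1 := prod_add_mul_pow (Polynomial.C q) (Polynomial.C (q ^ n)) (-Polynomial.X) (2 * n + 1)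
  have h2 : ∏ i ∈ Finset.range (2 * n + 1),
      (Polynomial.C (q ^ n) + -Polynomial.X * Polynomial.C q ^ i) =
      (1 - Polynomial.X) * (Polynomial.C (q ^ n) * ((∏ i ∈ Finset.range n,
        (Polynomial.C (q ^ n) + -Polynomial.X * Polynomial.C q ^ i)) *
        ∏ i ∈ Finset.range n,
          (Polynomial.C (q ^ n) + -Polynomial.X * Polynomial.C q ^ (n + 1 + i)))) := by
    rw [show 2 * n + 1 = n + 1 + n by ring, Finset.prod_range_add, Finset.prod_range_succ]
    simp only [map_pow]
    ring
  rw [h2] at h1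
  have h3 := congrArg (fun p => Polynomial.eval 1 (Polynomial.derivative p)) h1
  have h4 : ∀ k, Polynomial.eval 1 (Polynomial.derivative (Polynomial.C q ^ (k.choose 2) *
      qBinom (Polynomial.C q) (2 * n + 1) k *
        ((-Polynomial.X) ^ k * Polynomial.C (q ^ n) ^ (2 * n + 1 - k)))) =
      q ^ (k.choose 2) * qBinom q (2 * n + 1) k *
        ((-1) ^ k * (q ^ n) ^ (2 * n + 1 - k)) * k := by
    intro k
    have : Polynomial.C q ^ (k.choose 2) * qBinom (Polynomial.C q) (2 * n + 1) k *
        ((-Polynomial.X) ^ k * Polynomial.C (q ^ n) ^ (2 * n + 1 - k)) =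
      Polynomial.C (q ^ (k.choose 2) * qBinom q (2 * n + 1) k *
        ((-1) ^ k * (q ^ n) ^ (2 * n + 1 - k))) * Polynomial.X ^ k := by
      rw [← map_qBinom, neg_pow]
      simp only [map_mul, map_pow, map_neg, map_one]
      ring
    rw [this, Polynomial.derivative_C_mul_X_pow]
    simp
  simp only [Polynomial.derivative_sum, Polynomial.eval_finsetSum, h4] at h3
  rw [← h3, Polynomial.derivative_mul]
  have h5 := prod_range_pow_sub_pow q n
  have h6 := prod_range_pow_sub_pow_add q n
  simp [Polynomial.eval_prod, ← sub_eq_add_neg, h5, h6]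
  ring

theorem two_mul_choose_two_cast (n : ℕ) : 2 * ((n.choose 2 : ℕ) : ℤ) = n * (n - 1) := by
  have h := two_mul_choose_two n
  cases n with
  | zero => simp
  | succ n =>
    rw [Nat.add_sub_cancel] at h
    push_cast
    rw [add_sub_cancel_right]
    exact_mod_cast h

theorem qFact_X_ne_zero (k : ℕ) : qFact (X : ℤ⟦X⟧) k ≠ 0 := by
  intro h
  have := congrArg constantCoeff h
  simp [qFact] at this

theorem qBinom_X_symm (k l : ℕ) : qBinom (X : ℤ⟦X⟧) (k + l) l = qBinom X (k + l) k := by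
  have h1 := qBinom_mul_qFact (X : ℤ⟦X⟧) k l
  have h2 := qBinom_mul_qFact (X : ℤ⟦X⟧) l k
  rw [add_comm l k] at h2
  refine mul_right_cancel₀ (mul_ne_zero (qFact_X_ne_zero k) (qFact_X_ne_zero l)) ?_
  linear_combination h2 - h1

/-- The finite form of Jacobi's identity for the cube of the Euler product. -/
theorem sum_odd_mul_qBinom (n : ℕ) :
    ∑ j ∈ Finset.range (n + 1), (-1 : ℤ⟦X⟧) ^ j * (2 * (j : ℤ⟦X⟧) + 1) *
      X ^ ((j + 1).choose 2) * qBinom X (2 * n + 1) (n - j) = qFact X n ^ 2 := by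
  have h := sum_qBinom_derivative (X : ℤ⟦X⟧) n
  rw [show 2 * n + 1 + 1 = (n + 1) + (n + 1) by ring, Finset.sum_range_add,
    ← Finset.sum_range_reflect _ (n + 1), ← Finset.sum_add_distrib] at h
  have h1 : (-1 : ℤ⟦X⟧) ^ (n + 1) * X ^ (n + n.choose 2 + n * n) ≠ 0 :=
    mul_ne_zero (pow_ne_zero _ (by simp)) (pow_ne_zero _ X_ne_zero)
  refine mul_left_cancel₀ h1 (Eq.trans ?_ h)
  rw [Finset.mul_sum]
  refine Finset.sum_congr rfl fun j hj => ?_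
  obtain ⟨d, rfl⟩ := Nat.exists_eq_add_of_le (Nat.lt_succ_iff.1 (Finset.mem_range.1 hj))
  -- the terms with indices `n - j` and `n + 1 + j` have the same power of `X`
  have e1 : d.choose 2 + (j + d) * (2 * j + d + 1) =
      (j + d) + (j + d).choose 2 + (j + d) * (j + d) + (j + 1).choose 2 := by
    have a1 := two_mul_choose_two_cast d
    have a2 := two_mul_choose_two_cast (j + d)
    have a3 := two_mul_choose_two_cast (j + 1)
    zify
    push_cast at a1 a2 a3 ⊢
    linarith
  have e2 : (2 * j + d + 1).choose 2 + (j + d) * d =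
      (j + d) + (j + d).choose 2 + (j + d) * (j + d) + (j + 1).choose 2 := by
    have a1 := two_mul_choose_two_cast (2 * j + d + 1)
    have a2 := two_mul_choose_two_cast (j + d)
    have a3 := two_mul_choose_two_cast (j + 1)
    zify
    push_cast at a1 a2 a3 ⊢
    linarith
  have e3 := qBinom_X_symm d (2 * j + d + 1)
  rw [show j + d - j = d by omega, show j + d + 1 - 1 - j = d by omega,
    show 2 * (j + d) + 1 - d = 2 * j + d + 1 by omega,
    show j + d + 1 + j = 2 * j + d + 1 by omega,
    show 2 * (j + d) + 1 - (2 * j + d + 1) = d by omega]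
  rw [show d + (2 * j + d + 1) = 2 * (j + d) + 1 by ring] at e3
  rw [e3, ← pow_mul, ← pow_mul]
  have e1' := congrArg (fun e => (X : ℤ⟦X⟧) ^ e) e1
  have e2' := congrArg (fun e => (X : ℤ⟦X⟧) ^ e) e2
  simp only [pow_add _ (d.choose 2)] at e1'
  simp only [pow_add _ ((2 * j + d + 1).choose 2)] at e2'
  rw [pow_add _ _ ((j + 1).choose 2)] at e1' e2'
  have s1 : (-1 : ℤ⟦X⟧) ^ (2 * j + d + 1) = - (-1) ^ d := by
    rw [pow_succ, pow_add, pow_mul]; simp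
  have s2 : (-1 : ℤ⟦X⟧) ^ (j + d + 1) * (-1) ^ j = - (-1) ^ d := by
    rw [← pow_add, show j + d + 1 + j = 2 * j + d + 1 by ring, s1]
  rw [s1]
  push_cast
  linear_combination (-(-1 : ℤ⟦X⟧) ^ d * d * qBinom X (2 * (j + d) + 1) d) * e1' +
    ((-1 : ℤ⟦X⟧) ^ d * (2 * j + d + 1) * qBinom X (2 * (j + d) + 1) d) * e2' +
    ((2 * (j : ℤ⟦X⟧) + 1) * X ^ (j + d + (j + d).choose 2 + (j + d) * (j + d)) *
      X ^ ((j + 1).choose 2) * qBinom X (2 * (j + d) + 1) d) * s2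

/-- Jacobi's identity for the cube of the Euler product, up to the order `n`. -/
theorem X_pow_dvd_pentagonalSeries_cube_sub (n : ℕ) :
    (X : ℤ⟦X⟧) ^ (n + 1) ∣ pentagonalSeries ℤ ^ 3 -
      ∑ j ∈ Finset.range (n + 1), (-1 : ℤ⟦X⟧) ^ j * (2 * (j : ℤ⟦X⟧) + 1) *
        X ^ ((j + 1).choose 2) := by
  have h1 : (X : ℤ⟦X⟧) ^ (n + 1) ∣ pentagonalSeries ℤ ^ 3 - qFact X n ^ 2 * pentagonalSeries ℤ := by
    convert (X_pow_dvd_pentagonalSeries_sub_qFact n).mul_right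
      (pentagonalSeries ℤ * (pentagonalSeries ℤ + qFact X n)) using 1
    ring
  have h2 : (X : ℤ⟦X⟧) ^ (n + 1) ∣ ∑ j ∈ Finset.range (n + 1), (-1 : ℤ⟦X⟧) ^ j *
      (2 * (j : ℤ⟦X⟧) + 1) * (X ^ ((j + 1).choose 2) *
        (qBinom X (2 * n + 1) (n - j) * pentagonalSeries ℤ - 1)) := by
    refine Finset.dvd_sum fun j hj => Dvd.dvd.mul_left ?_ _
    have hj := Finset.mem_range.1 hj
    have h3 := X_pow_dvd_qBinom_mul_pentagonalSeries_sub_one (R := ℤ) (k := n - j) (l := n + 1 + j)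
      le_rfl (by omega)
    rw [show n - j + (n + 1 + j) = 2 * n + 1 by omega] at h3
    refine (pow_dvd_pow _ ?_).trans ((pow_add (X : ℤ⟦X⟧) _ _).symm ▸ mul_dvd_mul_left _ h3)
    have : j ≤ (j + 1).choose 2 := by
      rw [Nat.choose_succ_succ' j 1, Nat.choose_one_right]; exact Nat.le_add_right _ _
    omega
  convert dvd_add h1 h2 using 1
  rw [← sum_odd_mul_qBinom n, Finset.sum_mul, sub_add, ← Finset.sum_sub_distrib]
  congr 1
  exact Finset.sum_congr rfl fun j _ => by ring

/-- By Jacobi's identity the cube of the Euler product is supported on triangular numbers, so its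
coefficients vanish at the exponents congruent to `2` modulo `5`. -/
theorem coeff_pentagonalSeries_cube {m : ℕ} (hm : m % 5 = 2) :
    coeff m (pentagonalSeries ℤ ^ 3) = 0 := by
  have h := X_pow_dvd_iff.1 (X_pow_dvd_pentagonalSeries_cube_sub m) m (Nat.lt_succ_self m)
  rw [map_sub, sub_eq_zero] at h
  rw [h, map_sum]
  refine Finset.sum_eq_zero fun j _ => ?_
  have h1 : (-1 : ℤ⟦X⟧) ^ j * (2 * (j : ℤ⟦X⟧) + 1) = C ((-1) ^ j * (2 * (j : ℤ) + 1)) := by simp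
  have h2 : m ≠ (j + 1).choose 2 := by
    intro h
    have h3 := two_mul_choose_two (j + 1)
    rw [← h, Nat.add_sub_cancel] at h3
    have h4 : (j + 1) * j % 5 = 4 := by omega
    have h5 : j % 5 < 5 := Nat.mod_lt _ (by norm_num)
    rw [Nat.mul_mod, Nat.add_mod] at h4
    interval_cases j % 5 <;> omega
  rw [h1, coeff_C_mul, coeff_X_pow, if_neg h2, mul_zero]

end JacobiCube

/-! ### Series supported on a residue class modulo five -/

section ResidueClasses

variable {R : Type*} [CommRing R]

/-- The power series `f` involves only exponents in the residue class `r` modulo `5`. -/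
def InClass (r : ZMod 5) (f : R⟦X⟧) : Prop :=
  ∀ n : ℕ, (n : ZMod 5) ≠ r → coeff n f = 0

namespace InClass

variable {r s : ZMod 5} {f g : R⟦X⟧}

theorem add (hf : InClass r f) (hg : InClass r g) : InClass r (f + g) := fun n hn => by
  rw [map_add, hf n hn, hg n hn, add_zero]

theorem sub (hf : InClass r f) (hg : InClass r g) : InClass r (f - g) := fun n hn => by
  rw [map_sub, hf n hn, hg n hn, sub_zero]

theorem mul (hf : InClass r f) (hg : InClass s g) : InClass (r + s) (f * g) := fun n hn => by
  rw [coeff_mul]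
  refine Finset.sum_eq_zero fun p hp => ?_
  by_cases h1 : (p.1 : ZMod 5) = r
  · have h2 : (p.2 : ZMod 5) ≠ s := by
      rintro rfl
      apply hn
      rw [← h1, ← Nat.cast_add, Finset.HasAntidiagonal.mem_antidiagonal.1 hp]
    rw [hg _ h2, mul_zero]
  · rw [hf _ h1, zero_mul]

theorem one : InClass 0 (1 : R⟦X⟧) := fun n hn => by
  rw [coeff_one, if_neg]
  rintro rfl
  simp at hn

theorem pow (hf : InClass r f) (n : ℕ) : InClass (n * r) (f ^ n) := by
  induction n with
  | zero => simpa using one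
  | succ n ih => rw [pow_succ, Nat.cast_succ, add_mul, one_mul]; exact ih.mul hf

theorem X_pow (n : ℕ) : InClass n ((X : R⟦X⟧) ^ n) := fun m hm => by
  rw [coeff_X_pow, if_neg]
  rintro rfl
  exact hm rfl

theorem X : InClass 1 (X : R⟦X⟧) := by simpa using X_pow (R := R) 1

theorem expand (f : R⟦X⟧) : InClass 0 (expand 5 (by norm_num) f) := fun n hn =>
  coeff_expand_of_not_dvd 5 _ f fun h => hn ((ZMod.natCast_eq_zero_iff n 5).2 h)

theorem natCast_mul (n : ℕ) (hf : InClass r f) : InClass r ((n : R⟦X⟧) * f) := fun m hm => by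
  rw [← nsmul_eq_mul, map_nsmul, hf m hm, smul_zero]

theorem map {S : Type*} [CommRing S] (φ : R →+* S) (hf : InClass r f) :
    InClass r (PowerSeries.map φ f) := fun n hn => by
  rw [coeff_map, hf n hn, map_zero]

theorem rescale_eq {a : R} (ha : a ^ 5 = 1) {k : ℕ} (hf : InClass k f) :
    rescale a f = C (a ^ k) * f := by
  ext n
  rw [coeff_rescale, coeff_C_mul]
  by_cases h : (n : ZMod 5) = k
  · rw [pow_eq_pow_mod n ha, pow_eq_pow_mod k ha, (ZMod.natCast_eq_natCast_iff' n k 5).1 h]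
  · rw [hf n h, mul_zero, mul_zero]

end InClass

end ResidueClasses

/-! ### The quintic modular equation of the Euler product -/

section ModularEquation

/-- `∏ (1 - X ^ n)`. -/
local notation "E₁" => pentagonalSeries ℤ
/-- `∏ (1 - X ^ (5 n))`. -/
local notation "E₅" => expand 5 (by norm_num) (pentagonalSeries ℤ)
/-- `∏ (1 - X ^ (25 n))`. -/
local notation "E₂₅" => expand 5 (by norm_num) (expand 5 (by norm_num) (pentagonalSeries ℤ))

section Dissection

theorem pentagonal_mod_five (k : ℤ) :
    pentagonal k % 5 = 0 ∨ pentagonal k % 5 = 1 ∨ pentagonal k % 5 = 2 := by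
  have h := two_mul_natCast_pentagonal k
  have h1 : (2 * (pentagonal k : ℤ)) % 5 = (k % 5) * (3 * (k % 5) - 1) % 5 := by
    rw [h, Int.mul_emod, Int.sub_emod, Int.mul_emod 3]
    simp [Int.mul_emod, Int.sub_emod]
  have h2 := Int.emod_nonneg k (show (5 : ℤ) ≠ 0 by norm_num)
  have h3 := Int.emod_lt_of_pos k (show (0 : ℤ) < 5 by norm_num)
  interval_cases k % 5 <;> omega

theorem eq_one_sub_of_pentagonal_mod_five {k : ℤ} (h : pentagonal k % 5 = 1) :
    ∃ l, k = 1 - 5 * l := by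
  have h0 := two_mul_natCast_pentagonal k
  have h1 : (2 * (pentagonal k : ℤ)) % 5 = (k % 5) * (3 * (k % 5) - 1) % 5 := by
    rw [h0, Int.mul_emod, Int.sub_emod, Int.mul_emod 3]
    simp [Int.mul_emod, Int.sub_emod]
  have h2 := Int.emod_nonneg k (show (5 : ℤ) ≠ 0 by norm_num)
  have h3 := Int.emod_lt_of_pos k (show (0 : ℤ) < 5 by norm_num)
  have h4 : k % 5 = 1 := by
    generalize k % 5 = r at *
    interval_cases r <;> omega
  exact ⟨-(k / 5), by omega⟩

theorem pentagonal_one_sub_five_mul (l : ℤ) : pentagonal (1 - 5 * l) = 25 * pentagonal l + 1 := by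
  have h1 := two_mul_natCast_pentagonal l
  have h2 := two_mul_natCast_pentagonal (1 - 5 * l)
  zify
  linarith

theorem coeff_pentagonalSeries_five_mul_add_one (m : ℕ) :
    coeff (5 * m + 1) E₁ = -coeff m E₅ := by
  rw [coeff_expand]
  split_ifs with h
  · obtain ⟨p, rfl⟩ := h
    rw [Nat.mul_div_cancel_left _ (by norm_num)]
    by_cases hp : p ∈ Set.range pentagonal
    · obtain ⟨l, rfl⟩ := hp
      have h1 : 5 * (5 * pentagonal l) + 1 = pentagonal (1 - 5 * l) := by
        rw [pentagonal_one_sub_five_mul]; ring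
      have h2 : Int.negOnePow (1 - 5 * l) = - Int.negOnePow l := by
        rw [Int.negOnePow_sub, Int.negOnePow_one, show 5 * l = l + 2 * (2 * l) by ring,
          Int.negOnePow_add, Int.negOnePow_two_mul]
        simp
      rw [h1, coeff_pentagonalSeries_pentagonal, coeff_pentagonalSeries_pentagonal, h2]
      simp
    · rw [coeff_pentagonalSeries_eq_zero ℤ hp, coeff_pentagonalSeries_eq_zero, neg_zero]
      rintro ⟨k, hk⟩
      obtain ⟨l, rfl⟩ := eq_one_sub_of_pentagonal_mod_five (k := k) (by omega)
      rw [pentagonal_one_sub_five_mul] at hk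
      exact hp ⟨l, by omega⟩
  · rw [neg_zero]
    apply coeff_pentagonalSeries_eq_zero
    rintro ⟨k, hk⟩
    obtain ⟨l, rfl⟩ := eq_one_sub_of_pentagonal_mod_five (k := k) (by omega)
    rw [pentagonal_one_sub_five_mul] at hk
    omega

/-- The `5`-dissection of the Euler product, together with the relation `x z = y ^ 2` between its
components, which is the vanishing of the exponents `2 mod 5` in the cube of the Euler product. -/
theorem exists_dissection : ∃ x z : ℤ⟦X⟧, InClass 0 x ∧ InClass 2 z ∧
    E₁ = x - X * E₂₅ - z ∧ x * z = (X * E₂₅) ^ 2 := by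
  set y : ℤ⟦X⟧ := X * E₂₅ with hy
  set x : ℤ⟦X⟧ := mk fun n => if (n : ZMod 5) = 0 then coeff n E₁ else 0 with hx
  set z : ℤ⟦X⟧ := mk fun n => if (n : ZMod 5) = 2 then -coeff n E₁ else 0 with hz
  have hxc : InClass 0 x := fun n hn => by rw [hx, coeff_mk, if_neg hn]
  have hzc : InClass 2 z := fun n hn => by rw [hz, coeff_mk, if_neg hn]
  have hyc : InClass 1 y := by simpa using InClass.X.mul (InClass.expand _)
  have hE : E₁ = x - y - z := by
    ext n
    rw [map_sub, map_sub, hx, hz, coeff_mk, coeff_mk]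
    have h0 : ∀ r : ℕ, r < 5 → ((n : ZMod 5) = (r : ZMod 5) ↔ n % 5 = r) := fun r hr => by
      rw [ZMod.natCast_eq_natCast_iff', Nat.mod_eq_of_lt hr]
    have h00 := h0 0 (by norm_num)
    have h01 := h0 1 (by norm_num)
    have h02 := h0 2 (by norm_num)
    simp only [Nat.cast_zero, Nat.cast_one, Nat.cast_ofNat] at h00 h01 h02
    simp only [h00, h02]
    by_cases h1 : n % 5 = 1
    · obtain ⟨m, rfl⟩ : ∃ m, n = 5 * m + 1 := ⟨n / 5, by omega⟩
      rw [if_neg (by omega), if_neg (by omega), coeff_pentagonalSeries_five_mul_add_one, hy,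
        coeff_succ_X_mul, coeff_expand_mul]
      ring
    · rw [hyc n (by rwa [Ne, h01])]
      split_ifs with h2 h3
      · omega
      · ring
      · ring
      · rw [coeff_pentagonalSeries_eq_zero]
        · ring
        · rintro ⟨k, rfl⟩
          rcases pentagonal_mod_five k with h | h | h <;> omega
  refine ⟨x, z, hxc, hzc, hE, ?_⟩
  have hx0 : x ≠ 0 := by
    intro h
    have := congrArg (coeff 0) h
    simp [hx] at this
  have key : 3 * (x * (y ^ 2 - x * z)) = 0 := by
    have hcube : 3 * (x * (y ^ 2 - x * z)) = E₁ ^ 3 - (x ^ 3 - 3 * (y * z ^ 2)) +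
        (3 * (x ^ 2 * y) + z ^ 3) + (y ^ 3 - 6 * (x * y * z)) +
        (3 * (y ^ 2 * z) - 3 * (x * z ^ 2)) := by
      rw [hE]; ring
    have c2 : InClass 2 (3 * (x * (y ^ 2 - x * z))) := by
      have := (hxc.mul ((hyc.pow 2).sub (hxc.mul hzc))).natCast_mul 3
      simpa using this
    have c0 : InClass 0 (x ^ 3 - 3 * (y * z ^ 2)) := by
      have := (hxc.pow 3).sub ((hyc.mul (hzc.pow 2)).natCast_mul 3)
      simpa using this
    have c1 : InClass 1 (3 * (x ^ 2 * y) + z ^ 3) := by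
      have := (((hxc.pow 2).mul hyc).natCast_mul 3).add (hzc.pow 3)
      simpa using this
    have c3 : InClass 3 (y ^ 3 - 6 * (x * y * z)) := by
      have := (hyc.pow 3).sub (((hxc.mul hyc).mul hzc).natCast_mul 6)
      simpa using this
    have c4 : InClass 4 (3 * (y ^ 2 * z) - 3 * (x * z ^ 2)) := by
      rw [show (4 : ZMod 5) = 2 + 2 by decide]
      have := (((hyc.pow 2).mul hzc).natCast_mul 3).sub ((hxc.mul (hzc.pow 2)).natCast_mul 3)
      simpa using this
    ext n
    by_cases hn : (n : ZMod 5) = 2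
    · have h5 : n % 5 = 2 := by
        have := (ZMod.natCast_eq_natCast_iff' n 2 5).1 (by simpa using hn)
        simpa using this
      rw [hcube, map_add, map_add, map_add, map_sub, coeff_pentagonalSeries_cube h5,
        c0 n (by rw [hn]; decide), c1 n (by rw [hn]; decide), c3 n (by rw [hn]; decide),
        c4 n (by rw [hn]; decide)]
      simp
    · rw [c2 n hn, map_zero]
  have h3 : (3 : ℤ⟦X⟧) ≠ 0 := by
    intro h
    have := congrArg constantCoeff h
    rw [map_ofNat, map_zero] at this
    norm_num at this
  have := (mul_eq_zero.1 ((mul_eq_zero.1 key).resolve_left h3)).resolve_left hx0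
  exact (sub_eq_zero.1 this).symm

end Dissection

section Norm

variable {A : Type*} [CommRing A]

theorem prod_sub_pow_mul {ω : A} (hω : 1 + ω + ω ^ 2 + ω ^ 3 + ω ^ 4 = 0) (a b : A) :
    ∏ j ∈ Finset.range 5, (a - ω ^ j * b) = a ^ 5 - b ^ 5 := by
  have h5 : ω ^ 5 = 1 := by linear_combination (ω - 1) * hω
  have h1 : (a - ω * b) * (a - ω ^ 4 * b) = a ^ 2 - (ω + ω ^ 4) * a * b + b ^ 2 := by
    linear_combination b ^ 2 * h5
  have h2 : (a - ω ^ 2 * b) * (a - ω ^ 3 * b) = a ^ 2 - (ω ^ 2 + ω ^ 3) * a * b + b ^ 2 := by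
    linear_combination b ^ 2 * h5
  have h3 : (ω + ω ^ 4) * (ω ^ 2 + ω ^ 3) = -1 := by
    linear_combination hω + (ω + ω ^ 2) * h5
  simp only [Finset.prod_range_succ, Finset.prod_range_zero, pow_zero, one_mul, pow_one]
  calc (a - b) * (a - ω * b) * (a - ω ^ 2 * b) * (a - ω ^ 3 * b) * (a - ω ^ 4 * b)
      = (a - b) * (((a - ω * b) * (a - ω ^ 4 * b)) * ((a - ω ^ 2 * b) * (a - ω ^ 3 * b))) := by
        ring
    _ = a ^ 5 - b ^ 5 := by
        rw [h1, h2]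
        linear_combination (a - b) * a ^ 2 * b ^ 2 * h3 - (a - b) * (a ^ 2 + b ^ 2) * a * b * hω

/-- For `x z = y ^ 2` the product of `x - ω ^ j y - ω ^ (2 j) z` over the fifth roots of unity
`ω ^ j`. With `φ` and `ψ` the roots of `t ^ 2 = t + 1`, each factor times `z` splits as
`(y - φ ω ^ j z) (y - ψ ω ^ j z)`. -/
theorem prod_sub_sub [IsDomain A] {ω φ ψ x y z : A}
    (hω : 1 + ω + ω ^ 2 + ω ^ 3 + ω ^ 4 = 0) (hadd : φ + ψ = 1) (hmul : φ * ψ = -1)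
    (hz : z ≠ 0) (h : x * z = y ^ 2) :
    ∏ j ∈ Finset.range 5, (x - ω ^ j * y - ω ^ (2 * j) * z) = x ^ 5 - 11 * y ^ 5 - z ^ 5 := by
  have h1 : (∏ j ∈ Finset.range 5, (x - ω ^ j * y - ω ^ (2 * j) * z)) * z ^ 5 =
      (∏ j ∈ Finset.range 5, (y - ω ^ j * (φ * z))) *
        ∏ j ∈ Finset.range 5, (y - ω ^ j * (ψ * z)) := by
    have : z ^ 5 = ∏ _j ∈ Finset.range 5, z := by simp
    rw [this, ← Finset.prod_mul_distrib, ← Finset.prod_mul_distrib]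
    refine Finset.prod_congr rfl fun j _ => ?_
    rw [mul_comm 2 j, pow_mul]
    linear_combination h + y * ω ^ j * z * hadd - (ω ^ j) ^ 2 * z ^ 2 * hmul
  rw [prod_sub_pow_mul hω, prod_sub_pow_mul hω] at h1
  have h2 : φ ^ 5 + ψ ^ 5 = 11 := by
    have : ψ = 1 - φ := by linear_combination hadd
    subst this
    linear_combination 5 * (φ * (1 - φ) - 2) * hmul
  have h3 : φ ^ 5 * ψ ^ 5 = -1 := by rw [← mul_pow, hmul]; ring
  have h4 : x ^ 5 * z ^ 5 = y ^ 10 := by rw [← mul_pow, h]; ring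
  refine mul_right_cancel₀ (pow_ne_zero 5 hz) ?_
  linear_combination h1 - h4 - y ^ 5 * z ^ 5 * h2 + z ^ 10 * h3

/-- The product of the substitutions `X ↦ ω ^ j X` for `j < 5`. -/
noncomputable def norm5 (ω : A) (f : A⟦X⟧) : A⟦X⟧ :=
  ∏ j ∈ Finset.range 5, rescale (ω ^ j) f

theorem norm5_mul (ω : A) (f g : A⟦X⟧) : norm5 ω (f * g) = norm5 ω f * norm5 ω g := by
  simp [norm5, Finset.prod_mul_distrib]

theorem X_pow_dvd_rescale {a : A} {f : A⟦X⟧} {k : ℕ} (h : X ^ k ∣ f) : X ^ k ∣ rescale a f := by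
  obtain ⟨g, rfl⟩ := h
  rw [map_mul, map_pow, rescale_X, mul_pow]
  exact ⟨C a ^ k * rescale a g, by ring⟩

theorem dvd_prod_sub_prod {ι : Type*} {d : A} (s : Finset ι) {f g : ι → A}
    (h : ∀ i ∈ s, d ∣ f i - g i) : d ∣ ∏ i ∈ s, f i - ∏ i ∈ s, g i := by
  classical
  induction s using Finset.induction_on with
  | empty => simp
  | insert a s ha ih =>
    rw [Finset.prod_insert ha, Finset.prod_insert ha]
    have h1 := ih fun i hi => h i (Finset.mem_insert_of_mem hi)
    have h2 := h a (Finset.mem_insert_self a s)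
    convert dvd_add (h1.mul_left (f a)) (h2.mul_right (∏ i ∈ s, g i)) using 1
    ring

theorem X_pow_dvd_norm5_sub (ω : A) {f g : A⟦X⟧} {k : ℕ} (h : X ^ k ∣ f - g) :
    X ^ k ∣ norm5 ω f - norm5 ω g :=
  dvd_prod_sub_prod _ fun j _ => by rw [← map_sub]; exact X_pow_dvd_rescale h

theorem norm5_one_sub_X_pow {ω : A} (hω : 1 + ω + ω ^ 2 + ω ^ 3 + ω ^ 4 = 0) {n : ℕ}
    (hn : ¬ 5 ∣ n) : norm5 ω (1 - X ^ n) = 1 - X ^ (5 * n) := by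
  have h5 : ω ^ 5 = 1 := by linear_combination (ω - 1) * hω
  have h1 : 1 + ω ^ n + (ω ^ n) ^ 2 + (ω ^ n) ^ 3 + (ω ^ n) ^ 4 = 0 := by
    rw [pow_eq_pow_mod n h5]
    have : n % 5 < 5 := Nat.mod_lt _ (by norm_num)
    have hr : n % 5 ≠ 0 := by omega
    generalize n % 5 = r at *
    interval_cases r
    · exact absurd rfl hr
    · linear_combination hω
    · linear_combination hω + (ω + ω ^ 3) * h5
    · linear_combination hω + (ω + ω ^ 4 + ω ^ 2 * (ω ^ 5 + 1)) * h5
    · linear_combination hω + (ω ^ 3 + ω ^ 2 * (ω ^ 5 + 1) + ω * (ω ^ 10 + ω ^ 5 + 1)) * h5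
  have h2 := prod_sub_pow_mul (ω := C (ω ^ n)) (by
    simpa using congrArg C h1) (1 : A⟦X⟧) (X ^ n)
  rw [one_pow, ← pow_mul, mul_comm n] at h2
  rw [← h2, norm5]
  refine Finset.prod_congr rfl fun j _ => ?_
  rw [map_sub, map_one, map_pow, rescale_X, mul_pow, ← map_pow, ← map_pow, ← pow_mul, ← pow_mul,
    mul_comm j]

theorem norm5_one_sub_X_pow_five_mul {ω : A} (hω : ω ^ 5 = 1) (n : ℕ) :
    norm5 ω (1 - X ^ (5 * n)) = (1 - X ^ (5 * n)) ^ 5 := by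
  have : ∀ j ∈ Finset.range 5, rescale (ω ^ j) (1 - X ^ (5 * n)) = 1 - X ^ (5 * n) := by
    intro j _
    rw [map_sub, map_one, map_pow, rescale_X, mul_pow, ← map_pow, ← pow_mul,
      show j * (5 * n) = 5 * (j * n) by ring, pow_mul, hω]
    simp
  rw [norm5, Finset.prod_congr rfl this]
  simp

theorem norm5_qFact {ω : A} (hω : 1 + ω + ω ^ 2 + ω ^ 3 + ω ^ 4 = 0) (m : ℕ) :
    norm5 ω (qFact X (5 * m)) * qFact (X ^ 25) m =
      qFact (X ^ 5) (5 * m) * qFact (X ^ 5) m ^ 5 := by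
  have h5 : ω ^ 5 = 1 := by linear_combination (ω - 1) * hω
  induction m with
  | zero => simp [norm5]
  | succ m ih =>
    have h1 : ∀ q : A⟦X⟧, qFact q (5 * (m + 1)) = qFact q (5 * m) * (1 - q ^ (5 * m + 1)) *
        (1 - q ^ (5 * m + 2)) * (1 - q ^ (5 * m + 3)) * (1 - q ^ (5 * m + 4)) *
          (1 - q ^ (5 * (m + 1))) := fun q => by
      simp only [show 5 * (m + 1) = 5 * m + 1 + 1 + 1 + 1 + 1 by ring, qFact_succ]
    rw [h1, h1, norm5_mul, norm5_mul, norm5_mul, norm5_mul, norm5_mul,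
      norm5_one_sub_X_pow hω (by omega), norm5_one_sub_X_pow hω (by omega),
      norm5_one_sub_X_pow hω (by omega), norm5_one_sub_X_pow hω (by omega),
      norm5_one_sub_X_pow_five_mul h5, qFact_succ, qFact_succ]
    simp only [← pow_mul]
    rw [show 25 * (m + 1) = 5 * (5 * (m + 1)) by ring]
    linear_combination (1 - X ^ (5 * (5 * m + 1))) * (1 - X ^ (5 * (5 * m + 2))) *
      (1 - X ^ (5 * (5 * m + 3))) * (1 - X ^ (5 * (5 * m + 4))) * (1 - X ^ (5 * (5 * (m + 1)))) *
      (1 - X ^ (5 * (m + 1))) ^ 5 * ih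

theorem X_pow_dvd_expand {f : A⟦X⟧} {k p : ℕ} (hp : p ≠ 0) (h : X ^ k ∣ f) :
    X ^ k ∣ expand p hp f := by
  obtain ⟨g, rfl⟩ := h
  rw [map_mul, map_pow, expand_X, ← pow_mul]
  exact (pow_dvd_pow _ (Nat.le_mul_of_pos_left k (Nat.pos_of_ne_zero hp))).mul_right _

theorem norm5_pentagonalSeries {ω : A} (hω : 1 + ω + ω ^ 2 + ω ^ 3 + ω ^ 4 = 0) :
    norm5 ω (pentagonalSeries A) *
        expand 5 (by norm_num) (expand 5 (by norm_num) (pentagonalSeries A)) =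
      expand 5 (by norm_num) (pentagonalSeries A) ^ 6 := by
  rw [← sub_eq_zero]
  ext m
  rw [map_zero]
  have key : ∀ n, m ≤ n → (X : A⟦X⟧) ^ (m + 1) ∣ pentagonalSeries A - qFact X n := fun n hn =>
    (pow_dvd_pow _ (by omega)).trans (X_pow_dvd_pentagonalSeries_sub_qFact n)
  have k1 := X_pow_dvd_norm5_sub ω (key (5 * m) (by omega))
  have k2 := X_pow_dvd_expand (show 5 ≠ 0 by norm_num)
    (X_pow_dvd_expand (show 5 ≠ 0 by norm_num) (key m le_rfl))
  have k3 := X_pow_dvd_expand (show 5 ≠ 0 by norm_num) (key (5 * m) (by omega))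
  have k4 := X_pow_dvd_expand (show 5 ≠ 0 by norm_num) (key m le_rfl)
  have e : ∀ n, expand 5 (by norm_num) (qFact (X : A⟦X⟧) n) = qFact (X ^ 5) n := fun n => by
    rw [← expand_X 5 (by norm_num)]
    exact map_qFact (expand 5 (by norm_num) : A⟦X⟧ →ₐ[A] A⟦X⟧).toRingHom X n
  have e' : ∀ n, expand 5 (by norm_num) (qFact ((X : A⟦X⟧) ^ 5) n) = qFact (X ^ 25) n := fun n => by
    rw [show (X : A⟦X⟧) ^ 25 = expand 5 (by norm_num) (X ^ 5) by
      rw [map_pow, expand_X, ← pow_mul]]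
    exact map_qFact (expand 5 (by norm_num) : A⟦X⟧ →ₐ[A] A⟦X⟧).toRingHom (X ^ 5) n
  rw [map_sub, e] at k3 k4
  rw [map_sub, map_sub, e, e'] at k2
  obtain ⟨a1, ha1⟩ := k1
  obtain ⟨a2, ha2⟩ := k2
  obtain ⟨a3, ha3⟩ := k3
  have k5 : (X : A⟦X⟧) ^ (m + 1) ∣
      expand 5 (by norm_num) (pentagonalSeries A) ^ 5 - qFact (X ^ 5) m ^ 5 :=
    k4.trans (sub_dvd_pow_sub_pow _ _ 5)
  obtain ⟨a4, ha4⟩ := k5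
  have h := norm5_qFact hω m
  refine X_pow_dvd_iff.1 (?_ : (X : A⟦X⟧) ^ (m + 1) ∣ _) m (Nat.lt_succ_self m)
  rw [sub_eq_iff_eq_add] at ha1 ha2 ha3 ha4
  refine ⟨a1 * expand 5 (by norm_num) (expand 5 (by norm_num) (pentagonalSeries A)) +
    norm5 ω (qFact X (5 * m)) * a2 - a3 * expand 5 (by norm_num) (pentagonalSeries A) ^ 5 -
    qFact (X ^ 5) (5 * m) * a4, ?_⟩
  linear_combination h + expand 5 (by norm_num) (expand 5 (by norm_num) (pentagonalSeries A)) * ha1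
    + norm5 ω (qFact X (5 * m)) * ha2 - expand 5 (by norm_num) (pentagonalSeries A) ^ 5 * ha3
    - qFact (X ^ 5) (5 * m) * ha4

theorem map_pentagonalSeries {B : Type*} [CommRing B] (φ : A →+* B) :
    PowerSeries.map φ (pentagonalSeries A) = pentagonalSeries B := by
  ext n
  rw [coeff_map]
  by_cases h : n ∈ Set.range pentagonal
  · obtain ⟨k, rfl⟩ := h
    simp
  · rw [coeff_pentagonalSeries_eq_zero A h, coeff_pentagonalSeries_eq_zero B h, map_zero]

end Norm

section Quintic

/-- The product of the Euler product over the substitutions `X ↦ ω ^ j X` is evaluated in two ways: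
through the `5`-dissection and factor by factor. -/
theorem dissection_norm {x z : ℤ⟦X⟧} (hx : InClass 0 x) (hz : InClass 2 z) (hz0 : z ≠ 0)
    (hE : E₁ = x - X * E₂₅ - z) (h : x * z = (X * E₂₅) ^ 2) :
    (x ^ 5 - 11 * (X * E₂₅) ^ 5 - z ^ 5) * E₂₅ = E₅ ^ 6 := by
  obtain ⟨ω, hω⟩ : ∃ ω : ℂ, 1 + ω + ω ^ 2 + ω ^ 3 + ω ^ 4 = 0 := by
    have h1 := (Complex.isPrimitiveRoot_exp 5 (by norm_num)).geom_sum_eq_zero (by norm_num)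
    simp only [Finset.sum_range_succ, Finset.sum_range_zero, pow_zero, pow_one, zero_add] at h1
    exact ⟨_, h1⟩
  have h5 : ω ^ 5 = 1 := by linear_combination (ω - 1) * hω
  have hadd : ((Real.goldenRatio : ℂ)) + (Real.goldenConj : ℂ) = 1 := by
    exact_mod_cast Real.goldenRatio_add_goldenConj
  have hmul : ((Real.goldenRatio : ℂ)) * (Real.goldenConj : ℂ) = -1 := by
    exact_mod_cast Real.goldenRatio_mul_goldenConj
  set f := PowerSeries.map (Int.castRingHom ℂ) with hf
  have hinj : Function.Injective f := map_injective _ Int.cast_injective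
  have hy : InClass 1 (X * E₂₅) := by simpa using InClass.X.mul (InClass.expand (expand 5 _ E₁))
  set y := X * E₂₅ with hy'
  have h1 : norm5 ω (pentagonalSeries ℂ) = f (x ^ 5 - 11 * y ^ 5 - z ^ 5) := by
    have h2 := prod_sub_sub (A := ℂ⟦X⟧) (ω := C ω) (φ := C (Real.goldenRatio : ℂ))
      (ψ := C (Real.goldenConj : ℂ)) (x := f x) (y := f y) (z := f z)
      (by simpa using congrArg C hω) (by rw [← map_add, hadd, map_one])
      (by rw [← map_mul, hmul, map_neg, map_one]) (by rwa [Ne, map_eq_zero_iff f hinj])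
      (by rw [← map_mul, h, map_pow])
    rw [map_sub, map_sub, map_mul, map_pow, map_pow, map_pow, map_ofNat, ← h2, norm5]
    refine Finset.prod_congr rfl fun j _ => ?_
    have hj : (ω ^ j) ^ 5 = 1 := by rw [← pow_mul, mul_comm, pow_mul, h5, one_pow]
    have r0 := InClass.rescale_eq hj (k := 0) (by simpa using hx.map (Int.castRingHom ℂ))
    have r1 := InClass.rescale_eq hj (k := 1) (by simpa using hy.map (Int.castRingHom ℂ))
    have r2 := InClass.rescale_eq hj (k := 2) (by simpa using hz.map (Int.castRingHom ℂ))
    rw [← map_pentagonalSeries (Int.castRingHom ℂ), ← hf, hE, map_sub, map_sub, map_sub, map_sub]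
    rw [← hf] at r0 r1 r2
    rw [r0, r1, r2, ← pow_mul _ j 2, mul_comm j 2]
    simp
  have h3 := norm5_pentagonalSeries hω
  rw [h1, ← map_pentagonalSeries (Int.castRingHom ℂ), ← map_expand, ← map_expand, ← hf] at h3
  apply hinj
  rw [map_mul, map_pow]
  exact h3

/-- The modular equation of degree five for the Euler product. -/
theorem quintic : (E₁ ^ 5 + 5 * (X * E₂₅) * E₁ ^ 4 + 15 * (X * E₂₅) ^ 2 * E₁ ^ 3 +
    25 * (X * E₂₅) ^ 3 * E₁ ^ 2 + 25 * (X * E₂₅) ^ 4 * E₁) * E₂₅ = E₅ ^ 6 := by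
  obtain ⟨x, z, hx, hz, hE, h⟩ := exists_dissection
  have hz0 : z ≠ 0 := by
    rintro rfl
    rw [mul_zero] at h
    have := pow_eq_zero_iff (two_ne_zero) |>.1 h.symm
    have h1 := congrArg (coeff 1) this
    rw [show 1 = 0 + 1 from rfl, coeff_succ_X_mul] at h1
    simp at h1
  rw [← dissection_norm hx hz hz0 hE h]
  congr 1
  set y := X * E₂₅
  rw [hE]
  -- both sides agree modulo the relation `x z = y ^ 2`
  linear_combination (-5 * x ^ 3 + 10 * x ^ 2 * z - 5 * x * y ^ 2 - 10 * x * z ^ 2 +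
    5 * y ^ 2 * z + 5 * z ^ 3) * h

end Quintic

/-! ### The operator `U` on two Eisenstein series of level five -/

section SectionOperator

variable {R : Type*} [CommRing R]

/-- The operator `U` extracting the exponents divisible by five: `∑ a n X ^ n ↦ ∑ a (5 n) X ^ n`. -/
noncomputable def uFive (f : R⟦X⟧) : R⟦X⟧ :=
  mk fun n => coeff (5 * n) f

@[simp]
theorem coeff_uFive (f : R⟦X⟧) (n : ℕ) : coeff n (uFive f) = coeff (5 * n) f := coeff_mk _ _

theorem uFive_add (f g : R⟦X⟧) : uFive (f + g) = uFive f + uFive g := by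
  ext n; simp

@[simp]
theorem uFive_expand (f : R⟦X⟧) : uFive (expand 5 (by norm_num) f) = f := by
  ext n; simp

theorem uFive_expand_mul (g f : R⟦X⟧) :
    uFive (expand 5 (by norm_num) g * f) = g * uFive f := by
  ext n
  rw [coeff_uFive, coeff_mul, coeff_mul]
  symm
  refine Finset.sum_of_injOn (fun p => (5 * p.1, 5 * p.2)) ?_ ?_ ?_ ?_
  · rintro ⟨a, b⟩ _ ⟨c, d⟩ _ h
    simp only [Prod.mk.injEq] at h ⊢
    omega
  · rintro ⟨a, b⟩ h
    simp only [Finset.mem_coe, Finset.HasAntidiagonal.mem_antidiagonal] at h ⊢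
    omega
  · rintro ⟨a, b⟩ h h'
    rw [coeff_expand_of_not_dvd, zero_mul]
    rintro ⟨c, rfl⟩
    rw [Finset.HasAntidiagonal.mem_antidiagonal] at h
    dsimp only at h
    obtain rfl : b = 5 * (n - c) := by omega
    refine h' ⟨(c, n - c), ?_, rfl⟩
    rw [Finset.mem_coe, Finset.HasAntidiagonal.mem_antidiagonal]
    dsimp only
    omega
  · rintro ⟨a, b⟩ _
    simp

theorem InClass.uFive_eq_zero {r : ZMod 5} {f : R⟦X⟧} (hf : InClass r f) (hr : r ≠ 0) :
    uFive f = 0 := by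
  ext n
  rw [coeff_uFive, map_zero]
  refine hf _ ?_
  rw [(ZMod.natCast_eq_zero_iff _ 5).2 ⟨n, rfl⟩]
  exact hr.symm

theorem uFive_intCast_mul (k : ℤ) (f : R⟦X⟧) : uFive ((k : R⟦X⟧) * f) = (k : R⟦X⟧) * uFive f := by
  have := uFive_expand_mul (k : R⟦X⟧) f
  rwa [map_intCast] at this

end SectionOperator

section EisensteinSeries

/-- The inverse of the Euler product, the generating series of the partition function. -/
noncomputable def eulerInv : ℤ⟦X⟧ := invOfUnit E₁ 1

theorem pentagonalSeries_mul_eulerInv : E₁ * eulerInv = 1 := mul_invOfUnit _ _ (by simp)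

theorem expand_pentagonalSeries_mul_eulerInv : E₅ * expand 5 (by norm_num) eulerInv = 1 := by
  rw [← map_mul, pentagonalSeries_mul_eulerInv, map_one]

/-- The series `X ∏ (1 - X ^ (5 n)) ^ 5 / (1 - X ^ n)`, an Eisenstein series of weight two and
level five. -/
noncomputable def eisF : ℤ⟦X⟧ := X * E₅ ^ 5 * eulerInv

/-- The series `∏ (1 - X ^ n) ^ 5 / (1 - X ^ (5 n))`, the other Eisenstein series of weight two and
level five. -/
noncomputable def eisH : ℤ⟦X⟧ := E₁ ^ 5 * expand 5 (by norm_num) eulerInv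

local notation "F" => eisF
local notation "H" => eisH
/-- The series `F` at `X ^ 5`. -/
local notation "F'" => expand 5 (by norm_num) eisF
/-- The series `H` at `X ^ 5`. -/
local notation "H'" => expand 5 (by norm_num) eisH

theorem eisH_ne_zero : H ≠ 0 := by
  intro h
  have h1 : H * E₅ = E₁ ^ 5 := by
    rw [eisH, mul_assoc, mul_comm _ E₅, expand_pentagonalSeries_mul_eulerInv, mul_one]
  rw [h, zero_mul] at h1
  have := congrArg constantCoeff h1
  simp at this

theorem eisF_pow_five_mul_eisH : F ^ 5 * H = F' * H' ^ 5 := by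
  have h1 := pentagonalSeries_mul_eulerInv
  have h5 := expand_pentagonalSeries_mul_eulerInv
  have h25 := congrArg (expand 5 (by norm_num)) h5
  rw [map_mul, map_one] at h25
  simp only [eisF, eisH, map_mul, map_pow, expand_X]
  calc _ = (E₁ * eulerInv) ^ 5 * (E₅ * expand 5 (by norm_num) eulerInv) * X ^ 5 * E₅ ^ 24 := by ring
    _ = (E₂₅ * expand 5 (by norm_num) (expand 5 (by norm_num) eulerInv)) ^ 5 *
        (E₅ * expand 5 (by norm_num) eulerInv) * X ^ 5 * E₅ ^ 24 := by rw [h1, h25]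
    _ = _ := by ring

/-- The modular equation of degree five, as a relation between the two Eisenstein series and their
expansions. -/
theorem expand_eisH_pow_five : H' ^ 5 =
    H * (H' ^ 4 + 5 * F * H' ^ 3 + 15 * F ^ 2 * H' ^ 2 + 25 * F ^ 3 * H' + 25 * F ^ 4) := by
  have h1 := pentagonalSeries_mul_eulerInv
  have h5 := expand_pentagonalSeries_mul_eulerInv
  have h25 := congrArg (expand 5 (by norm_num)) h5
  rw [map_mul, map_one] at h25
  have hF : F = X * E₂₅ * H' * eulerInv := by
    simp only [eisF, eisH, map_mul, map_pow]
    linear_combination (-X * E₅ ^ 5 * eulerInv) * h25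
  have hH' : H' = E₅ ^ 5 * expand 5 (by norm_num) (expand 5 (by norm_num) eulerInv) := by
    simp only [eisH, map_mul, map_pow]
  have hq := quintic
  set i := eulerInv
  set i5 := expand 5 (by norm_num) i
  set i25 := expand 5 (by norm_num) i5
  rw [hF]
  set y := X * E₂₅
  calc H' ^ 5 = (E₅ * i5) * (E₅ ^ 5 * i25) * H' ^ 4 := by rw [h5, ← hH']; ring
    _ = i5 * (E₅ ^ 6) * i25 * H' ^ 4 := by ring
    _ = i5 * (E₁ ^ 5 + 5 * y * E₁ ^ 4 * (E₁ * i) + 15 * y ^ 2 * E₁ ^ 3 * (E₁ * i) ^ 2 +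
        25 * y ^ 3 * E₁ ^ 2 * (E₁ * i) ^ 3 + 25 * y ^ 4 * E₁ * (E₁ * i) ^ 4) * (E₂₅ * i25) *
          H' ^ 4 := by
        rw [← hq, h1]; ring
    _ = _ := by rw [h25, eisH]; ring

/-- Trivial powers are kept in the monomials to which this lemma is applied, so that it can be used
as a rewrite rule. -/
theorem uFive_monomial_eq_zero {x y z : ℤ⟦X⟧} (hx : InClass 0 x) (hy : InClass 1 y)
    (hz : InClass 2 z) {s a b c : ℕ} (k : ℤ) (h : ¬ 5 ∣ s + b + 2 * c) :
    uFive ((k : ℤ⟦X⟧) * (X ^ s * (x ^ a * y ^ b * z ^ c))) = 0 := by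
  have h1 := (InClass.X_pow (R := ℤ) s).mul (((hx.pow a).mul (hy.pow b)).mul (hz.pow c))
  rw [uFive_intCast_mul, h1.uFive_eq_zero, mul_zero]
  intro h2
  refine h ((ZMod.natCast_eq_zero_iff _ 5).1 ?_)
  rw [← h2]
  push_cast
  ring

/-- If the component of `E₁ ^ m` in the class of `m` is `v y ^ m`, where `y = X E₂₅`, then `U` maps
`F ^ (5 - m) H`, which is `X ^ (5 - m) E₁ ^ m` up to a series in `X ^ 5`, to `v F H ^ (5 - m)`. -/
theorem uFive_eisF_pow_mul_eisH_of_component {m s : ℕ} (hms : m + s = 5) (hm : m ≤ 4) {v : ℤ}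
    (h : uFive (X ^ s * E₁ ^ m) = (v : ℤ⟦X⟧) * uFive (X ^ s * (X * E₂₅) ^ m)) :
    uFive (H * F ^ s) = (v : ℤ⟦X⟧) * (F * H ^ s) := by
  have h1 := pentagonalSeries_mul_eulerInv
  have h5 := expand_pentagonalSeries_mul_eulerInv
  have e1 : X ^ s * (X * E₂₅) ^ m = expand 5 (by norm_num) (X * E₅ ^ m) := by
    rw [map_mul, map_pow, expand_X, mul_pow, ← mul_assoc, ← pow_add, add_comm s, hms]
  rw [e1, uFive_expand] at h
  obtain ⟨l, hl⟩ : ∃ l, 5 * s = l + 1 := ⟨5 * s - 1, by omega⟩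
  have e2 : H * F ^ s = expand 5 (by norm_num) (E₁ ^ l) * (X ^ s * E₁ ^ m) := by
    simp only [eisF, eisH, mul_pow, ← pow_mul, hl, map_pow]
    have : E₁ ^ 5 = E₁ ^ m * E₁ ^ s := by rw [← pow_add, hms]
    rw [this]
    calc _ = (E₁ * eulerInv) ^ s * (E₅ * expand 5 (by norm_num) eulerInv) * E₅ ^ l *
          X ^ s * E₁ ^ m := by ring
      _ = _ := by rw [h1, h5]; ring
  have e3 : F * H ^ s = E₁ ^ l * (X * E₅ ^ m) := by
    simp only [eisF, eisH, mul_pow, ← pow_mul, hl]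
    have : E₅ ^ 5 = E₅ ^ m * E₅ ^ s := by rw [← pow_add, hms]
    rw [this]
    calc _ = (E₁ * eulerInv) * (E₅ * expand 5 (by norm_num) eulerInv) ^ s * E₁ ^ l *
          X * E₅ ^ m := by ring
      _ = _ := by rw [h1, h5]; ring
  rw [e2, e3, uFive_expand_mul, h]
  ring

/-- The component of `E₁` in the class `1` is `-y`. In the expansion of `X ^ 4 E₁` all other
monomials miss the exponents divisible by five. -/
theorem uFive_eisH_mul_eisF_pow_4 : uFive (H * F ^ 4) = -1 * (F * H ^ 4) := by
  obtain ⟨x, z, hx, hz, hE, h⟩ := exists_dissection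
  have hy : InClass 1 (X * E₂₅) := by simpa using InClass.X.mul (InClass.expand (expand 5 _ E₁))
  have h0 := @uFive_monomial_eq_zero _ _ _ hx hy hz
  have key := uFive_eisF_pow_mul_eisH_of_component (m := 1) (s := 4) rfl (by norm_num) (v := -1) ?_
  · simpa using key
  set y := X * E₂₅
  have e : X ^ 4 * E₁ ^ 1 = ((-1 : ℤ) : ℤ⟦X⟧) * (X ^ 4 * y ^ 1) +
      ((1 : ℤ) : ℤ⟦X⟧) * (X ^ 4 * (x ^ 1 * y ^ 0 * z ^ 0)) +
      ((-1 : ℤ) : ℤ⟦X⟧) * (X ^ 4 * (x ^ 0 * y ^ 0 * z ^ 1)) := by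
    rw [hE]
    push_cast
    ring
  rw [e]
  simp +decide only [uFive_add, h0, uFive_intCast_mul, add_zero]

/-- The component of `E₁ ^ 2` in the class `2` is `y ^ 2 - 2 x z = -y ^ 2`. -/
theorem uFive_eisH_mul_eisF_pow_3 : uFive (H * F ^ 3) = -1 * (F * H ^ 3) := by
  obtain ⟨x, z, hx, hz, hE, h⟩ := exists_dissection
  have hy : InClass 1 (X * E₂₅) := by simpa using InClass.X.mul (InClass.expand (expand 5 _ E₁))
  have h0 := @uFive_monomial_eq_zero _ _ _ hx hy hz
  have key := uFive_eisF_pow_mul_eisH_of_component (m := 2) (s := 3) rfl (by norm_num) (v := -1) ?_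
  · simpa using key
  set y := X * E₂₅
  have e : X ^ 3 * E₁ ^ 2 = ((-1 : ℤ) : ℤ⟦X⟧) * (X ^ 3 * y ^ 2) +
      ((1 : ℤ) : ℤ⟦X⟧) * (X ^ 3 * (x ^ 2 * y ^ 0 * z ^ 0)) +
      ((-2 : ℤ) : ℤ⟦X⟧) * (X ^ 3 * (x ^ 1 * y ^ 1 * z ^ 0)) +
      ((2 : ℤ) : ℤ⟦X⟧) * (X ^ 3 * (x ^ 0 * y ^ 1 * z ^ 1)) +
      ((1 : ℤ) : ℤ⟦X⟧) * (X ^ 3 * (x ^ 0 * y ^ 0 * z ^ 2)) := by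
    rw [hE]
    push_cast
    linear_combination -2 * X ^ 3 * h
  rw [e]
  simp +decide only [uFive_add, h0, uFive_intCast_mul, add_zero]

/-- The component of `E₁ ^ 3` in the class `3` is `6 x y z - y ^ 3 = 5 y ^ 3`. -/
theorem uFive_eisH_mul_eisF_pow_2 : uFive (H * F ^ 2) = 5 * (F * H ^ 2) := by
  obtain ⟨x, z, hx, hz, hE, h⟩ := exists_dissection
  have hy : InClass 1 (X * E₂₅) := by simpa using InClass.X.mul (InClass.expand (expand 5 _ E₁))
  have h0 := @uFive_monomial_eq_zero _ _ _ hx hy hz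
  have key := uFive_eisF_pow_mul_eisH_of_component (m := 3) (s := 2) rfl (by norm_num) (v := 5) ?_
  · simpa using key
  set y := X * E₂₅
  have e : X ^ 2 * E₁ ^ 3 = ((5 : ℤ) : ℤ⟦X⟧) * (X ^ 2 * y ^ 3) +
      ((-3 : ℤ) : ℤ⟦X⟧) * (X ^ 2 * (x ^ 0 * y ^ 1 * z ^ 2)) +
      ((1 : ℤ) : ℤ⟦X⟧) * (X ^ 2 * (x ^ 3 * y ^ 0 * z ^ 0)) +
      ((-1 : ℤ) : ℤ⟦X⟧) * (X ^ 2 * (x ^ 0 * y ^ 0 * z ^ 3)) +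
      ((-3 : ℤ) : ℤ⟦X⟧) * (X ^ 2 * (x ^ 2 * y ^ 1 * z ^ 0)) +
      ((3 : ℤ) : ℤ⟦X⟧) * (X ^ 2 * (x ^ 1 * y ^ 2 * z ^ 0)) +
      ((-3 : ℤ) : ℤ⟦X⟧) * (X ^ 2 * (x ^ 2 * y ^ 0 * z ^ 1)) +
      ((-3 : ℤ) : ℤ⟦X⟧) * (X ^ 2 * (x ^ 0 * y ^ 2 * z ^ 1)) +
      ((3 : ℤ) : ℤ⟦X⟧) * (X ^ 2 * (x ^ 1 * y ^ 0 * z ^ 2)) := by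
    rw [hE]
    push_cast
    linear_combination 6 * X ^ 2 * y * h
  rw [e]
  simp +decide only [uFive_add, h0, uFive_intCast_mul, add_zero]

/-- The component of `E₁ ^ 4` in the class `4` is
`y ^ 4 - 12 x y ^ 2 z + 6 x ^ 2 z ^ 2 = -5 y ^ 4`. -/
theorem uFive_eisH_mul_eisF_pow_1 : uFive (H * F ^ 1) = -5 * (F * H ^ 1) := by
  obtain ⟨x, z, hx, hz, hE, h⟩ := exists_dissection
  have hy : InClass 1 (X * E₂₅) := by simpa using InClass.X.mul (InClass.expand (expand 5 _ E₁))
  have h0 := @uFive_monomial_eq_zero _ _ _ hx hy hz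
  have key := uFive_eisF_pow_mul_eisH_of_component (m := 4) (s := 1) rfl (by norm_num) (v := -5) ?_
  · simpa using key
  set y := X * E₂₅
  have e : X ^ 1 * E₁ ^ 4 = ((-5 : ℤ) : ℤ⟦X⟧) * (X ^ 1 * y ^ 4) +
      ((4 : ℤ) : ℤ⟦X⟧) * (X ^ 1 * (x ^ 0 * y ^ 3 * z ^ 1)) +
      ((-12 : ℤ) : ℤ⟦X⟧) * (X ^ 1 * (x ^ 1 * y ^ 1 * z ^ 2)) +
      ((1 : ℤ) : ℤ⟦X⟧) * (X ^ 1 * (x ^ 4 * y ^ 0 * z ^ 0)) +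
      ((6 : ℤ) : ℤ⟦X⟧) * (X ^ 1 * (x ^ 0 * y ^ 2 * z ^ 2)) +
      ((-4 : ℤ) : ℤ⟦X⟧) * (X ^ 1 * (x ^ 1 * y ^ 0 * z ^ 3)) +
      ((-4 : ℤ) : ℤ⟦X⟧) * (X ^ 1 * (x ^ 3 * y ^ 1 * z ^ 0)) +
      ((4 : ℤ) : ℤ⟦X⟧) * (X ^ 1 * (x ^ 0 * y ^ 1 * z ^ 3)) +
      ((6 : ℤ) : ℤ⟦X⟧) * (X ^ 1 * (x ^ 2 * y ^ 2 * z ^ 0)) +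
      ((-4 : ℤ) : ℤ⟦X⟧) * (X ^ 1 * (x ^ 3 * y ^ 0 * z ^ 1)) +
      ((1 : ℤ) : ℤ⟦X⟧) * (X ^ 1 * (x ^ 0 * y ^ 0 * z ^ 4)) +
      ((-4 : ℤ) : ℤ⟦X⟧) * (X ^ 1 * (x ^ 1 * y ^ 3 * z ^ 0)) +
      ((12 : ℤ) : ℤ⟦X⟧) * (X ^ 1 * (x ^ 2 * y ^ 1 * z ^ 1)) := by
    rw [hE]
    push_cast
    linear_combination X * (6 * x * z - 6 * y ^ 2) * h
  rw [e]
  simp +decide only [uFive_add, h0, uFive_intCast_mul, add_zero]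

theorem uFive_sum_five {a₁ a₂ a₃ a₄ a₅ b₁ b₂ b₃ b₄ b₅ g f : ℤ⟦X⟧}
    (h : expand 5 (by norm_num) g * f = expand 5 (by norm_num) a₁ * b₁ +
      expand 5 (by norm_num) a₂ * b₂ + expand 5 (by norm_num) a₃ * b₃ +
      expand 5 (by norm_num) a₄ * b₄ + expand 5 (by norm_num) a₅ * b₅) :
    g * uFive f = a₁ * uFive b₁ + a₂ * uFive b₂ + a₃ * uFive b₃ + a₄ * uFive b₄ +
      a₅ * uFive b₅ := by
  have h1 := congrArg uFive h
  simpa only [uFive_add, uFive_expand_mul] using h1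

/-! The modular equation multiplied by `H ^ i F ^ j`, after an application of `U`, is a linear
relation between the images of monomials under `U`. In it `F ^ 5 H` has been replaced by
`F' H' ^ 5`, so that the exponents of `F` stay below `5`. -/

theorem eisH_pow_5_mul_uFive_eisF_pow_0 (i : ℕ) : H ^ 5 * uFive (H ^ i * F ^ 0) =
    H ^ 4 * uFive (H ^ (i + 1) * F ^ 0) +
      5 * H ^ 3 * uFive (H ^ (i + 1) * F ^ 1) +
      15 * H ^ 2 * uFive (H ^ (i + 1) * F ^ 2) +
      25 * H * uFive (H ^ (i + 1) * F ^ 3) +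
      25 * uFive (H ^ (i + 1) * F ^ 4) := by
  apply uFive_sum_five
  simp only [map_mul, map_pow, map_ofNat]
  linear_combination H ^ i * F ^ 0 * expand_eisH_pow_five

theorem eisH_pow_5_mul_uFive_eisF_pow_1 (i : ℕ) : H ^ 5 * uFive (H ^ i * F ^ 1) =
    H ^ 4 * uFive (H ^ (i + 1) * F ^ 1) +
      5 * H ^ 3 * uFive (H ^ (i + 1) * F ^ 2) +
      15 * H ^ 2 * uFive (H ^ (i + 1) * F ^ 3) +
      25 * H * uFive (H ^ (i + 1) * F ^ 4) +
      25 * (F * H ^ 5) * uFive (H ^ i * F ^ 0) := by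
  apply uFive_sum_five
  simp only [map_mul, map_pow, map_ofNat]
  linear_combination H ^ i * F ^ 1 * expand_eisH_pow_five +
    25 * H ^ i * F ^ 0 * eisF_pow_five_mul_eisH

theorem eisH_pow_5_mul_uFive_eisF_pow_2 (i : ℕ) : H ^ 5 * uFive (H ^ i * F ^ 2) =
    H ^ 4 * uFive (H ^ (i + 1) * F ^ 2) +
      5 * H ^ 3 * uFive (H ^ (i + 1) * F ^ 3) +
      15 * H ^ 2 * uFive (H ^ (i + 1) * F ^ 4) +
      25 * (F * H ^ 6) * uFive (H ^ i * F ^ 0) +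
      25 * (F * H ^ 5) * uFive (H ^ i * F ^ 1) := by
  apply uFive_sum_five
  simp only [map_mul, map_pow, map_ofNat]
  linear_combination H ^ i * F ^ 2 * expand_eisH_pow_five +
    25 * H ^ i * F ^ 0 * H' * eisF_pow_five_mul_eisH +
    25 * H ^ i * F ^ 1 * eisF_pow_five_mul_eisH

theorem eisH_pow_5_mul_uFive_eisF_pow_3 (i : ℕ) : H ^ 5 * uFive (H ^ i * F ^ 3) =
    H ^ 4 * uFive (H ^ (i + 1) * F ^ 3) +
      5 * H ^ 3 * uFive (H ^ (i + 1) * F ^ 4) +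
      15 * (F * H ^ 7) * uFive (H ^ i * F ^ 0) +
      25 * (F * H ^ 6) * uFive (H ^ i * F ^ 1) +
      25 * (F * H ^ 5) * uFive (H ^ i * F ^ 2) := by
  apply uFive_sum_five
  simp only [map_mul, map_pow, map_ofNat]
  linear_combination H ^ i * F ^ 3 * expand_eisH_pow_five +
    15 * H ^ i * F ^ 0 * H' ^ 2 * eisF_pow_five_mul_eisH +
    25 * H ^ i * F ^ 1 * H' * eisF_pow_five_mul_eisH +
    25 * H ^ i * F ^ 2 * eisF_pow_five_mul_eisH

theorem eisH_pow_5_mul_uFive_eisF_pow_4 (i : ℕ) : H ^ 5 * uFive (H ^ i * F ^ 4) =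
    H ^ 4 * uFive (H ^ (i + 1) * F ^ 4) +
      5 * (F * H ^ 8) * uFive (H ^ i * F ^ 0) +
      15 * (F * H ^ 7) * uFive (H ^ i * F ^ 1) +
      25 * (F * H ^ 6) * uFive (H ^ i * F ^ 2) +
      25 * (F * H ^ 5) * uFive (H ^ i * F ^ 3) := by
  apply uFive_sum_five
  simp only [map_mul, map_pow, map_ofNat]
  linear_combination H ^ i * F ^ 4 * expand_eisH_pow_five +
    5 * H ^ i * F ^ 0 * H' ^ 3 * eisF_pow_five_mul_eisH +
    15 * H ^ i * F ^ 1 * H' ^ 2 * eisF_pow_five_mul_eisH +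
    25 * H ^ i * F ^ 2 * H' * eisF_pow_five_mul_eisH +
    25 * H ^ i * F ^ 3 * eisF_pow_five_mul_eisH

theorem uFive_one : uFive (1 : ℤ⟦X⟧) = 1 := by
  simpa using uFive_expand (1 : ℤ⟦X⟧)

theorem uFive_eisH_pow_0_mul_eisF_pow_0 : uFive (H ^ 0 * F ^ 0) = 1 := by
  simpa using uFive_one

theorem uFive_eisH_pow_1_mul_eisF_pow_1 : uFive (H ^ 1 * F ^ 1) = -5 * (F * H ^ 1) := by
  simpa only [pow_one] using uFive_eisH_mul_eisF_pow_1

theorem uFive_eisH_pow_1_mul_eisF_pow_2 : uFive (H ^ 1 * F ^ 2) = 5 * (F * H ^ 2) := by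
  simpa only [pow_one] using uFive_eisH_mul_eisF_pow_2

theorem uFive_eisH_pow_1_mul_eisF_pow_3 : uFive (H ^ 1 * F ^ 3) = -1 * (F * H ^ 3) := by
  simpa only [pow_one] using uFive_eisH_mul_eisF_pow_3

theorem uFive_eisH_pow_1_mul_eisF_pow_4 : uFive (H ^ 1 * F ^ 4) = -1 * (F * H ^ 4) := by
  simpa only [pow_one] using uFive_eisH_mul_eisF_pow_4

theorem uFive_eisH_pow_1_mul_eisF_pow_0 : uFive (H ^ 1 * F ^ 0) = H := by
  have h := eisH_pow_5_mul_uFive_eisF_pow_0 0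
  norm_num only [uFive_eisH_pow_0_mul_eisF_pow_0, uFive_eisH_pow_1_mul_eisF_pow_1,
    uFive_eisH_pow_1_mul_eisF_pow_2, uFive_eisH_pow_1_mul_eisF_pow_3,
    uFive_eisH_pow_1_mul_eisF_pow_4] at h
  refine mul_left_cancel₀ (pow_ne_zero 4 eisH_ne_zero) ?_
  linear_combination -h

theorem uFive_eisH_pow_0_mul_eisF_pow_1 : uFive (H ^ 0 * F ^ 1) = 5 * F := by
  have h := eisH_pow_5_mul_uFive_eisF_pow_1 0
  norm_num only [uFive_eisH_pow_0_mul_eisF_pow_0, uFive_eisH_pow_1_mul_eisF_pow_1,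
    uFive_eisH_pow_1_mul_eisF_pow_2, uFive_eisH_pow_1_mul_eisF_pow_3,
    uFive_eisH_pow_1_mul_eisF_pow_4] at h
  refine mul_left_cancel₀ (pow_ne_zero 5 eisH_ne_zero) ?_
  linear_combination h

theorem uFive_eisH_pow_0_mul_eisF_pow_2 : uFive (H ^ 0 * F ^ 2) =
    10 * (F * H) + 125 * F ^ 2 := by
  have h := eisH_pow_5_mul_uFive_eisF_pow_2 0
  norm_num only [uFive_eisH_pow_0_mul_eisF_pow_0, uFive_eisH_pow_0_mul_eisF_pow_1,
    uFive_eisH_pow_1_mul_eisF_pow_2, uFive_eisH_pow_1_mul_eisF_pow_3,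
    uFive_eisH_pow_1_mul_eisF_pow_4] at h
  refine mul_left_cancel₀ (pow_ne_zero 5 eisH_ne_zero) ?_
  linear_combination h

theorem uFive_eisH_pow_0_mul_eisF_pow_3 : uFive (H ^ 0 * F ^ 3) =
    9 * (F * H ^ 2) + 375 * (F ^ 2 * H) + 3125 * F ^ 3 := by
  have h := eisH_pow_5_mul_uFive_eisF_pow_3 0
  norm_num only [uFive_eisH_pow_0_mul_eisF_pow_0, uFive_eisH_pow_0_mul_eisF_pow_1,
    uFive_eisH_pow_0_mul_eisF_pow_2, uFive_eisH_pow_1_mul_eisF_pow_3,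
    uFive_eisH_pow_1_mul_eisF_pow_4] at h
  refine mul_left_cancel₀ (pow_ne_zero 5 eisH_ne_zero) ?_
  linear_combination h

theorem uFive_eisH_pow_0_mul_eisF_pow_4 : uFive (H ^ 0 * F ^ 4) =
    4 * (F * H ^ 3) + 550 * (F ^ 2 * H ^ 2) + 12500 * (F ^ 3 * H) + 78125 * F ^ 4 := by
  have h := eisH_pow_5_mul_uFive_eisF_pow_4 0
  norm_num only [uFive_eisH_pow_0_mul_eisF_pow_0, uFive_eisH_pow_0_mul_eisF_pow_1,
    uFive_eisH_pow_0_mul_eisF_pow_2, uFive_eisH_pow_0_mul_eisF_pow_3,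
    uFive_eisH_pow_1_mul_eisF_pow_4] at h
  refine mul_left_cancel₀ (pow_ne_zero 5 eisH_ne_zero) ?_
  linear_combination h

theorem uFive_eisH_pow_2_mul_eisF_pow_4 : uFive (H ^ 2 * F ^ 4) =
    -6 * (F * H ^ 5) - 25 * (F ^ 2 * H ^ 4) := by
  have h := eisH_pow_5_mul_uFive_eisF_pow_4 1
  norm_num only [uFive_eisH_pow_1_mul_eisF_pow_0, uFive_eisH_pow_1_mul_eisF_pow_1,
    uFive_eisH_pow_1_mul_eisF_pow_2, uFive_eisH_pow_1_mul_eisF_pow_3,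
    uFive_eisH_pow_1_mul_eisF_pow_4] at h
  refine mul_left_cancel₀ (pow_ne_zero 4 eisH_ne_zero) ?_
  linear_combination -h

theorem uFive_eisH_pow_2_mul_eisF_pow_3 : uFive (H ^ 2 * F ^ 3) =
    14 * (F * H ^ 4) + 125 * (F ^ 2 * H ^ 3) := by
  have h := eisH_pow_5_mul_uFive_eisF_pow_3 1
  norm_num only [uFive_eisH_pow_1_mul_eisF_pow_0, uFive_eisH_pow_1_mul_eisF_pow_1,
    uFive_eisH_pow_1_mul_eisF_pow_2, uFive_eisH_pow_1_mul_eisF_pow_3,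
    uFive_eisH_pow_2_mul_eisF_pow_4] at h
  refine mul_left_cancel₀ (pow_ne_zero 4 eisH_ne_zero) ?_
  linear_combination -h

theorem uFive_eisH_pow_2_mul_eisF_pow_2 : uFive (H ^ 2 * F ^ 2) =
    -125 * (F ^ 2 * H ^ 2) := by
  have h := eisH_pow_5_mul_uFive_eisF_pow_2 1
  norm_num only [uFive_eisH_pow_1_mul_eisF_pow_0, uFive_eisH_pow_1_mul_eisF_pow_1,
    uFive_eisH_pow_1_mul_eisF_pow_2, uFive_eisH_pow_2_mul_eisF_pow_3,
    uFive_eisH_pow_2_mul_eisF_pow_4] at h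
  refine mul_left_cancel₀ (pow_ne_zero 4 eisH_ne_zero) ?_
  linear_combination -h

theorem uFive_eisH_pow_2_mul_eisF_pow_1 : uFive (H ^ 2 * F ^ 1) =
    -90 * (F * H ^ 2) - 625 * (F ^ 2 * H) := by
  have h := eisH_pow_5_mul_uFive_eisF_pow_1 1
  norm_num only [uFive_eisH_pow_1_mul_eisF_pow_0, uFive_eisH_pow_1_mul_eisF_pow_1,
    uFive_eisH_pow_2_mul_eisF_pow_2, uFive_eisH_pow_2_mul_eisF_pow_3,
    uFive_eisH_pow_2_mul_eisF_pow_4] at h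
  refine mul_left_cancel₀ (pow_ne_zero 4 eisH_ne_zero) ?_
  linear_combination -h

theorem uFive_eisH_pow_2_mul_eisF_pow_0 : uFive (H ^ 2 * F ^ 0) =
    H ^ 2 + 250 * (F * H) + 2500 * F ^ 2 := by
  have h := eisH_pow_5_mul_uFive_eisF_pow_0 1
  norm_num only [uFive_eisH_pow_1_mul_eisF_pow_0, uFive_eisH_pow_2_mul_eisF_pow_1,
    uFive_eisH_pow_2_mul_eisF_pow_2, uFive_eisH_pow_2_mul_eisF_pow_3,
    uFive_eisH_pow_2_mul_eisF_pow_4] at h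
  refine mul_left_cancel₀ (pow_ne_zero 4 eisH_ne_zero) ?_
  linear_combination -h

theorem uFive_eisH_pow_3_mul_eisF_pow_4 : uFive (H ^ 3 * F ^ 4) =
    -11 * (F * H ^ 6) - 275 * (F ^ 2 * H ^ 5) - 3125 * (F ^ 3 * H ^ 4) := by
  have h := eisH_pow_5_mul_uFive_eisF_pow_4 2
  norm_num only [uFive_eisH_pow_2_mul_eisF_pow_0, uFive_eisH_pow_2_mul_eisF_pow_1,
    uFive_eisH_pow_2_mul_eisF_pow_2, uFive_eisH_pow_2_mul_eisF_pow_3,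
    uFive_eisH_pow_2_mul_eisF_pow_4] at h
  refine mul_left_cancel₀ (pow_ne_zero 4 eisH_ne_zero) ?_
  linear_combination -h

theorem uFive_eisH_pow_3_mul_eisF_pow_3 : uFive (H ^ 3 * F ^ 3) =
    54 * (F * H ^ 5) - 3125 * (F ^ 3 * H ^ 3) := by
  have h := eisH_pow_5_mul_uFive_eisF_pow_3 2
  norm_num only [uFive_eisH_pow_2_mul_eisF_pow_0, uFive_eisH_pow_2_mul_eisF_pow_1,
    uFive_eisH_pow_2_mul_eisF_pow_2, uFive_eisH_pow_2_mul_eisF_pow_3,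
    uFive_eisH_pow_3_mul_eisF_pow_4] at h
  refine mul_left_cancel₀ (pow_ne_zero 4 eisH_ne_zero) ?_
  linear_combination -h

theorem uFive_eisH_pow_3_mul_eisF_pow_2 : uFive (H ^ 3 * F ^ 2) =
    -130 * (F * H ^ 4) + 15625 * (F ^ 3 * H ^ 2) := by
  have h := eisH_pow_5_mul_uFive_eisF_pow_2 2
  norm_num only [uFive_eisH_pow_2_mul_eisF_pow_0, uFive_eisH_pow_2_mul_eisF_pow_1,
    uFive_eisH_pow_2_mul_eisF_pow_2, uFive_eisH_pow_3_mul_eisF_pow_3,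
    uFive_eisH_pow_3_mul_eisF_pow_4] at h
  refine mul_left_cancel₀ (pow_ne_zero 4 eisH_ne_zero) ?_
  linear_combination -h

theorem uFive_eisH_pow_3_mul_eisF_pow_1 : uFive (H ^ 3 * F ^ 1) =
    -15625 * (F ^ 3 * H) := by
  have h := eisH_pow_5_mul_uFive_eisF_pow_1 2
  norm_num only [uFive_eisH_pow_2_mul_eisF_pow_0, uFive_eisH_pow_2_mul_eisF_pow_1,
    uFive_eisH_pow_3_mul_eisF_pow_2, uFive_eisH_pow_3_mul_eisF_pow_3,
    uFive_eisH_pow_3_mul_eisF_pow_4] at h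
  refine mul_left_cancel₀ (pow_ne_zero 4 eisH_ne_zero) ?_
  linear_combination -h

theorem uFive_ofNat_mul (n : ℕ) [n.AtLeastTwo] (f : ℤ⟦X⟧) :
    uFive (ofNat(n) * f) = ofNat(n) * uFive f := by
  simpa using uFive_intCast_mul (OfNat.ofNat n) f

/-! The monomials below keep trivial powers, so that the values computed above apply as rewrite
rules. -/

theorem uFive_eisF_pow_2 : uFive (F ^ 2) =
    10 * (H ^ 1 * F ^ 1) + 125 * (H ^ 0 * F ^ 2) := by
  have h := uFive_eisH_pow_0_mul_eisF_pow_2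
  rw [pow_zero, one_mul] at h
  rw [h]
  ring

theorem uFive_uFive_eisF_pow_2 : uFive (uFive (F ^ 2)) =
    25 * (48 * (H ^ 1 * F ^ 1) + 625 * (H ^ 0 * F ^ 2)) := by
  rw [uFive_eisF_pow_2]
  simp only [uFive_add, uFive_ofNat_mul, uFive_eisH_pow_1_mul_eisF_pow_1,
    uFive_eisH_pow_0_mul_eisF_pow_2]
  ring

theorem uFive_uFive_uFive_eisF_pow_2 : uFive (uFive (uFive (F ^ 2))) =
    125 * (1202 * (H ^ 1 * F ^ 1) + 15625 * (H ^ 0 * F ^ 2)) := by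
  rw [uFive_uFive_eisF_pow_2]
  simp only [uFive_add, uFive_ofNat_mul, uFive_eisH_pow_1_mul_eisF_pow_1,
    uFive_eisH_pow_0_mul_eisF_pow_2]
  ring

theorem uFive_eisF_pow_3 : uFive (F ^ 3) =
    9 * (H ^ 2 * F ^ 1) + 375 * (H ^ 1 * F ^ 2) + 3125 * (H ^ 0 * F ^ 3) := by
  have h := uFive_eisH_pow_0_mul_eisF_pow_3
  rw [pow_zero, one_mul] at h
  rw [h]
  ring

theorem uFive_uFive_eisF_pow_3 : uFive (uFive (F ^ 3)) =
    5 * (5838 * (H ^ 2 * F ^ 1) + 233250 * (H ^ 1 * F ^ 2) + 1953125 * (H ^ 0 * F ^ 3)) := by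
  rw [uFive_eisF_pow_3]
  simp only [uFive_add, uFive_ofNat_mul, uFive_eisH_pow_2_mul_eisF_pow_1,
    uFive_eisH_pow_1_mul_eisF_pow_2, uFive_eisH_pow_0_mul_eisF_pow_3]
  ring

theorem uFive_uFive_uFive_eisF_pow_3 : uFive (uFive (uFive (F ^ 3))) =
    25 * (3643791 * (H ^ 2 * F ^ 1) + 145754625 * (H ^ 1 * F ^ 2) +
      1220703125 * (H ^ 0 * F ^ 3)) := by
  rw [uFive_uFive_eisF_pow_3]
  simp only [uFive_add, uFive_ofNat_mul, uFive_eisH_pow_2_mul_eisF_pow_1,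
    uFive_eisH_pow_1_mul_eisF_pow_2, uFive_eisH_pow_0_mul_eisF_pow_3]
  ring

theorem uFive_eisF_pow_4 : uFive (F ^ 4) =
    4 * (H ^ 3 * F ^ 1) + 550 * (H ^ 2 * F ^ 2) + 12500 * (H ^ 1 * F ^ 3) +
      78125 * (H ^ 0 * F ^ 4) := by
  have h := uFive_eisH_pow_0_mul_eisF_pow_4
  rw [pow_zero, one_mul] at h
  rw [h]
  ring

theorem uFive_uFive_eisF_pow_4 : uFive (uFive (F ^ 4)) =
    3125 * (96 * (H ^ 3 * F ^ 1) + 13728 * (H ^ 2 * F ^ 2) + 312480 * (H ^ 1 * F ^ 3) +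
      1953125 * (H ^ 0 * F ^ 4)) := by
  rw [uFive_eisF_pow_4]
  simp only [uFive_add, uFive_ofNat_mul, uFive_eisH_pow_3_mul_eisF_pow_1,
    uFive_eisH_pow_2_mul_eisF_pow_2, uFive_eisH_pow_1_mul_eisF_pow_3,
    uFive_eisH_pow_0_mul_eisF_pow_4]
  ring

theorem uFive_uFive_uFive_eisF_pow_4 : uFive (uFive (uFive (F ^ 4))) =
    15625 * (1500004 * (H ^ 3 * F ^ 1) + 214500550 * (H ^ 2 * F ^ 2) + 4882512500 * (H ^ 1 * F ^ 3) +
      30517578125 * (H ^ 0 * F ^ 4)) := by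
  rw [uFive_uFive_eisF_pow_4]
  simp only [uFive_add, uFive_ofNat_mul, uFive_eisH_pow_3_mul_eisF_pow_1,
    uFive_eisH_pow_2_mul_eisF_pow_2, uFive_eisH_pow_1_mul_eisF_pow_3,
    uFive_eisH_pow_0_mul_eisF_pow_4]
  ring

end EisensteinSeries

end ModularEquation

/-! ### Beta-sets of Young diagrams -/

section BetaSets

namespace YoungDiagram

/-- The beta-set (set of first column hook numbers) of a Young diagram with at most `N` rows,
padded with empty rows to `N` rows. -/
def betaSet (μ : YoungDiagram) (N : ℕ) : Finset ℕ :=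
  (Finset.range N).image fun i => μ.rowLen i + (N - 1 - i)

theorem mem_betaSet {μ : YoungDiagram} {N x : ℕ} :
    x ∈ μ.betaSet N ↔ ∃ i < N, μ.rowLen i + (N - 1 - i) = x := by
  simp [betaSet]

theorem beta_injOn (μ : YoungDiagram) (N : ℕ) :
    Set.InjOn (fun i => μ.rowLen i + (N - 1 - i)) (Finset.range N) := by
  intro i hi j hj h
  simp only [Finset.coe_range, Set.mem_Iio] at hi hj
  dsimp only at h
  rcases lt_trichotomy i j with hij | hij | hij
  · have := μ.rowLen_anti i j hij.le
    omega
  · exact hij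
  · have := μ.rowLen_anti j i hij.le
    omega

theorem card_betaSet (μ : YoungDiagram) (N : ℕ) : (μ.betaSet N).card = N := by
  rw [betaSet, Finset.card_image_of_injOn (μ.beta_injOn N), Finset.card_range]

theorem card_eq_sum_rowLen {μ : YoungDiagram} {N : ℕ} (hN : μ.colLen 0 ≤ N) :
    μ.card = ∑ i ∈ Finset.range N, μ.rowLen i := by
  have h1 : ∀ c ∈ μ.cells, c.1 ∈ Finset.range N := by
    rintro ⟨i, j⟩ hc
    have h2 : i < μ.colLen j := mem_iff_lt_colLen.1 hc
    have h3 := μ.colLen_anti 0 j (Nat.zero_le _)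
    simp only [Finset.mem_range]
    omega
  rw [show μ.card = μ.cells.card from rfl, Finset.card_eq_sum_card_fiberwise h1]
  refine Finset.sum_congr rfl fun i _ => ?_
  rw [rowLen_eq_card]
  rfl

theorem sum_betaSet {μ : YoungDiagram} {N : ℕ} (hN : μ.colLen 0 ≤ N) :
    ∑ x ∈ μ.betaSet N, x = N.choose 2 + μ.card := by
  rw [betaSet, Finset.sum_image (μ.beta_injOn N), Finset.sum_add_distrib, card_eq_sum_rowLen hN,
    Finset.sum_range_reflect (fun i => i) N, Finset.sum_range_id, Nat.choose_two_right, add_comm]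

theorem rowLen_add_notMem_betaSet {μ : YoungDiagram} {N : ℕ} (hN : μ.colLen 0 ≤ N) (j : ℕ) :
    j + (N - μ.colLen j) ∉ μ.betaSet N := by
  rw [mem_betaSet]
  rintro ⟨i, hi, h⟩
  have h3 := μ.colLen_anti 0 j (Nat.zero_le _)
  by_cases hij : (i, j) ∈ μ
  · have h1 := mem_iff_lt_rowLen.1 hij
    have h2 := mem_iff_lt_colLen.1 hij
    omega
  · have h1 := mt mem_iff_lt_rowLen.2 hij
    have h2 := mt mem_iff_lt_colLen.2 hij
    omega

/-- The gaps of the beta-set correspond to the columns of the diagram. -/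
theorem exists_of_notMem_betaSet {μ : YoungDiagram} {N y : ℕ} (hN : μ.colLen 0 ≤ N)
    (hy : y ∉ μ.betaSet N) : ∃ j, j + (N - μ.colLen j) = y := by
  classical
  have hex : ∃ i, i = N ∨ μ.rowLen i + (N - 1 - i) < y := ⟨N, Or.inl rfl⟩
  set i := Nat.find hex with hi
  have h1 := Nat.find_spec hex
  rw [← hi] at h1
  have h2 : i ≤ N := Nat.find_min' hex (Or.inl rfl)
  have h3 : ∀ k < i, y < μ.rowLen k + (N - 1 - k) := by
    intro k hk
    have h4 := Nat.find_min hex hk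
    push Not at h4
    refine lt_of_le_of_ne h4.2 fun h5 => hy (mem_betaSet.2 ⟨k, by omega, h5.symm⟩)
  refine ⟨y + i - N, ?_⟩
  have h0 := μ.colLen_anti 0 (y + i - N) (Nat.zero_le _)
  have h5 : μ.colLen (y + i - N) ≤ i := by
    rcases h1 with h1 | h1
    · omega
    · by_contra h6
      have := mem_iff_lt_rowLen.1 (mem_iff_lt_colLen.2 (not_le.1 h6))
      omega
  have h6 : i ≤ μ.colLen (y + i - N) := by
    rcases Nat.eq_zero_or_pos i with h7 | h7
    · omega
    · have h8 := h3 (i - 1) (by omega)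
      have : (i - 1, y + i - N) ∈ μ := mem_iff_lt_rowLen.2 (by omega)
      have := mem_iff_lt_colLen.1 this
      omega
  omega

/-- The `t`-cores are the diagrams whose beta-set is closed under subtraction of `t`: the hook
numbers in row `i` are the differences between the `i`-th element of the beta-set and the smaller
gaps. -/
theorem isTCore_iff_betaSet {μ : YoungDiagram} {N t : ℕ} (ht : 0 < t) (hN : μ.colLen 0 ≤ N) :
    μ.IsTCore t ↔ ∀ x ∈ μ.betaSet N, t ≤ x → x - t ∈ μ.betaSet N := by
  constructor
  · intro h x hx htx
    by_contra hy
    obtain ⟨i, hi, rfl⟩ := mem_betaSet.1 hx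
    obtain ⟨j, hj⟩ := exists_of_notMem_betaSet hN hy
    have h3 := μ.colLen_anti 0 j (Nat.zero_le _)
    by_cases hij : (i, j) ∈ μ
    · refine h i j hij ⟨1, ?_⟩
      have h1 := mem_iff_lt_rowLen.1 hij
      have h2 := mem_iff_lt_colLen.1 hij
      rw [hookNumber]
      omega
    · have h1 := mt mem_iff_lt_rowLen.2 hij
      have h2 := mt mem_iff_lt_colLen.2 hij
      omega
  · intro h i j hij hdvd
    have h1 := mem_iff_lt_rowLen.1 hij
    have h2 := mem_iff_lt_colLen.1 hij
    have h3 := μ.colLen_anti 0 j (Nat.zero_le _)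
    obtain ⟨k, hk⟩ := hdvd
    have h4 : ∀ l, t * l ≤ μ.rowLen i + (N - 1 - i) →
        μ.rowLen i + (N - 1 - i) - t * l ∈ μ.betaSet N := by
      intro l
      induction l with
      | zero => exact fun _ => mem_betaSet.2 ⟨i, by omega, by simp⟩
      | succ l ih =>
        intro hl
        rw [Nat.mul_succ] at hl ⊢
        have := h _ (ih (by omega)) (by omega)
        rwa [Nat.sub_sub] at this
    rw [hookNumber] at hk
    refine rowLen_add_notMem_betaSet hN j ?_
    have h5 := h4 k (by omega)
    rwa [show μ.rowLen i + (N - 1 - i) - t * k = j + (N - μ.colLen j) by omega] at h5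

theorem rowLen_eq_zero {μ : YoungDiagram} {i : ℕ} (h : μ.colLen 0 ≤ i) : μ.rowLen i = 0 := by
  by_contra h1
  have h2 : (i, 0) ∈ μ := mem_iff_lt_rowLen.2 (Nat.pos_of_ne_zero h1)
  have := mem_iff_lt_colLen.1 h2
  omega

theorem beta_eq_orderEmbOfFin (μ : YoungDiagram) {N : ℕ} {X : Finset ℕ} (hX : X.card = N)
    (h : μ.betaSet N = X) (k : Fin N) :
    μ.rowLen (N - 1 - k) + k = X.orderEmbOfFin hX k := by
  have h1 := Finset.orderEmbOfFin_unique (s := X) hX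
    (f := fun k : Fin N => μ.rowLen (N - 1 - k) + k)
    (fun k => by
      rw [← h, mem_betaSet]
      exact ⟨N - 1 - k, by omega, by omega⟩)
    (fun k l hkl => by
      have h2 := μ.rowLen_anti (N - 1 - l) (N - 1 - k) (by have : (k : ℕ) < l := hkl; omega)
      have : (k : ℕ) < l := hkl
      dsimp only
      omega)
  exact congrFun h1 k

theorem betaSet_inj {μ ν : YoungDiagram} {N : ℕ} (hμ : μ.colLen 0 ≤ N) (hν : ν.colLen 0 ≤ N)
    (h : μ.betaSet N = ν.betaSet N) : μ = ν := by
  have key : ∀ i, μ.rowLen i = ν.rowLen i := by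
    intro i
    by_cases hi : i < N
    · have h1 := beta_eq_orderEmbOfFin μ (ν.card_betaSet N) h ⟨N - 1 - i, by omega⟩
      have h2 := beta_eq_orderEmbOfFin ν (ν.card_betaSet N) rfl ⟨N - 1 - i, by omega⟩
      rw [← h2] at h1
      simp only [show N - 1 - (N - 1 - i) = i by omega] at h1
      omega
    · rw [rowLen_eq_zero (by omega), rowLen_eq_zero (by omega)]
  ext ⟨i, j⟩
  rw [mem_cells, mem_cells, mem_iff_lt_rowLen, mem_iff_lt_rowLen, key]

theorem exists_betaSet_eq {N : ℕ} {X : Finset ℕ} (hX : X.card = N) :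
    ∃ μ : YoungDiagram, μ.colLen 0 ≤ N ∧ μ.betaSet N = X := by
  set e := X.orderEmbOfFin hX with he
  have hmono : ∀ k l : Fin N, k ≤ l → e k + (l - k) ≤ e l := by
    suffices h : ∀ (d : ℕ) (k l : Fin N), (l : ℕ) = k + d → e k + d ≤ e l by
      intro k l hkl
      have : (k : ℕ) ≤ l := hkl
      exact h _ k l (by omega)
    intro d
    induction d with
    | zero => intro k l h; rw [Fin.ext (h.trans (add_zero _)), add_zero]
    | succ d ih =>
      intro k l h
      have h1 := ih k ⟨k + d, by omega⟩ rfl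
      have h2 : e ⟨k + d, by omega⟩ < e l := e.strictMono (Fin.mk_lt_of_lt_val (by omega))
      omega
  have hge : ∀ k : Fin N, (k : ℕ) ≤ e k := by
    intro k
    have := hmono ⟨0, k.pos⟩ k (Fin.mk_le_of_le_val (Nat.zero_le _))
    simp only at this
    omega
  let w : List ℕ := List.ofFn fun i : Fin N => e i.rev - i.rev
  have hw : w.SortedGE := by
    rw [List.sortedGE_iff_pairwise, List.pairwise_ofFn]
    intro i j hij
    have hr : j.rev ≤ i.rev := Fin.rev_le_rev.2 hij.le
    have h1 := hmono _ _ hr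
    have : ((j.rev : Fin N) : ℕ) ≤ i.rev := hr
    omega
  have hlen : w.length = N := List.length_ofFn
  have hrow : ∀ i (hi : i < N), (ofRowLens w hw).rowLen i = e (Fin.rev ⟨i, hi⟩) - (N - 1 - i) := by
    intro i hi
    have := rowLen_ofRowLens (hw := hw) ⟨i, by rw [hlen]; exact hi⟩
    rw [this]
    simp [w, Fin.val_rev, Nat.sub_sub, add_comm]
  refine ⟨ofRowLens w hw, ?_, ?_⟩
  · by_contra h
    have h1 : (N, 0) ∈ ofRowLens w hw := mem_iff_lt_colLen.2 (not_le.1 h)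
    rw [mem_ofRowLens] at h1
    obtain ⟨h2, -⟩ := h1
    rw [hlen] at h2
    exact absurd h2 (lt_irrefl _)
  · apply Finset.eq_of_subset_of_card_le
    · intro x hx
      obtain ⟨i, hi, rfl⟩ := mem_betaSet.1 hx
      have h1 := hge (Fin.rev ⟨i, hi⟩)
      have h2 : ((Fin.rev ⟨i, hi⟩ : Fin N) : ℕ) = N - 1 - i := by rw [Fin.val_rev]; simp only; omega
      rw [hrow i hi, ← h2, Nat.sub_add_cancel h1]
      exact Finset.orderEmbOfFin_mem X hX _
    · rw [hX, card_betaSet]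

end YoungDiagram

end BetaSets

/-! ### Cores and bead arrangements -/

section Abacus

/-- The set of positions of beads on an abacus with `t` runners, with the beads pushed up: runner
`r` carries beads at `r, r + t, …, r + t (c r - 1)`. -/
def abacus {t : ℕ} (c : Fin t → ℕ) : Finset ℕ :=
  Finset.univ.biUnion fun r : Fin t => (Finset.range (c r)).image fun j => (r : ℕ) + t * j

variable {t : ℕ}

theorem mem_abacus {c : Fin t → ℕ} {r : Fin t} {j : ℕ} : (r : ℕ) + t * j ∈ abacus c ↔ j < c r := by
  have ht : 0 < t := r.pos
  simp only [abacus, Finset.mem_biUnion, Finset.mem_univ, true_and, Finset.mem_image,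
    Finset.mem_range]
  constructor
  · rintro ⟨s, k, hk, h⟩
    have h1 := congrArg (· % t) h
    have h2 := congrArg (· / t) h
    simp only [Nat.add_mul_mod_self_left, Nat.mod_eq_of_lt s.isLt, Nat.mod_eq_of_lt r.isLt] at h1
    simp only [Nat.add_mul_div_left _ _ ht, Nat.div_eq_of_lt s.isLt, Nat.div_eq_of_lt r.isLt,
      zero_add] at h2
    rw [← Fin.ext h1, ← h2]
    exact hk
  · exact fun h => ⟨r, j, h, rfl⟩

theorem abacus_injective : Function.Injective (abacus : (Fin t → ℕ) → Finset ℕ) := by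
  intro c c' h
  funext r
  refine eq_of_forall_lt_iff fun j => ?_
  rw [← mem_abacus, ← mem_abacus, h]

theorem sum_abacus {A : Type*} [AddCommMonoid A] (c : Fin t → ℕ) (f : ℕ → A) :
    ∑ x ∈ abacus c, f x = ∑ r, ∑ j ∈ Finset.range (c r), f (r + t * j) := by
  rw [abacus, Finset.sum_biUnion]
  · refine Finset.sum_congr rfl fun r _ => Finset.sum_image fun j _ k _ h => ?_
    exact Nat.eq_of_mul_eq_mul_left r.pos (Nat.add_left_cancel h)
  · intro r _ s _ hrs
    rw [Function.onFun, Finset.disjoint_left]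
    simp only [Finset.mem_image, Finset.mem_range]
    rintro _ ⟨j, -, rfl⟩ ⟨k, -, h⟩
    have h1 := congrArg (· % t) h
    simp only [Nat.add_mul_mod_self_left, Nat.mod_eq_of_lt s.isLt, Nat.mod_eq_of_lt r.isLt] at h1
    exact hrs (Fin.ext h1.symm)

theorem card_abacus (c : Fin t → ℕ) : (abacus c).card = ∑ r, c r := by
  rw [Finset.card_eq_sum_ones, sum_abacus]
  simp

/-- The sum of the bead positions. -/
def abacusWeight (c : Fin t → ℕ) : ℕ := ∑ r : Fin t, ((r : ℕ) * c r + t * (c r).choose 2)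

theorem sum_id_abacus (c : Fin t → ℕ) : ∑ x ∈ abacus c, x = abacusWeight c := by
  rw [sum_abacus, abacusWeight]
  refine Finset.sum_congr rfl fun r _ => ?_
  rw [Finset.sum_add_distrib, ← Finset.mul_sum, Finset.sum_range_id, Nat.choose_two_right]
  simp [mul_comm]

theorem sub_mem_abacus {c : Fin t → ℕ} {x : ℕ} (hx : x ∈ abacus c) (h : t ≤ x) :
    x - t ∈ abacus c := by
  rcases Nat.eq_zero_or_pos t with rfl | ht
  · exact hx
  · have e : x = ((⟨x % t, Nat.mod_lt _ ht⟩ : Fin t) : ℕ) + t * (x / t) :=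
      (Nat.mod_add_div x t).symm
    rw [e, mem_abacus] at hx
    obtain ⟨k, hk⟩ := Nat.exists_eq_add_of_le' (Nat.div_pos h ht)
    rw [hk] at hx
    have e' : x - t = ((⟨x % t, Nat.mod_lt _ ht⟩ : Fin t) : ℕ) + t * k := by
      have := Nat.mod_add_div x t
      rw [hk, Nat.mul_succ] at this
      simp only
      omega
    rw [e', mem_abacus]
    omega

theorem exists_abacus_eq (ht : 0 < t) {X : Finset ℕ} (hX : ∀ x ∈ X, t ≤ x → x - t ∈ X) :
    ∃ c : Fin t → ℕ, abacus c = X := by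
  classical
  have hex : ∀ r : Fin t, ∃ j, (r : ℕ) + t * j ∉ X := by
    intro r
    by_contra! h
    refine Set.infinite_of_injective_forall_mem (f := fun j : ℕ => (r : ℕ) + t * j) ?_ h
      X.finite_toSet
    intro j k hjk
    exact Nat.eq_of_mul_eq_mul_left ht (Nat.add_left_cancel hjk)
  refine ⟨fun r => Nat.find (hex r), ?_⟩
  ext x
  have e : x = ((⟨x % t, Nat.mod_lt _ ht⟩ : Fin t) : ℕ) + t * (x / t) := (Nat.mod_add_div x t).symm
  rw [e, mem_abacus]
  generalize (⟨x % t, Nat.mod_lt _ ht⟩ : Fin t) = r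
  generalize x / t = j
  rw [Nat.lt_find_iff]
  constructor
  · exact fun h => not_not.1 (h j le_rfl)
  · intro h k hk
    rw [not_not]
    obtain ⟨d, rfl⟩ := Nat.exists_eq_add_of_le hk
    clear hk
    induction d with
    | zero => exact h
    | succ d ih =>
      refine ih ?_
      have := hX _ h (by nlinarith)
      rwa [show (r : ℕ) + t * (k + (d + 1)) - t = r + t * (k + d) by
        rw [← add_assoc k, Nat.mul_succ]; omega] at this

/-- The number of `t`-cores of size `n`. -/
noncomputable def coreCount (t n : ℕ) : ℕ :=
  {μ : YoungDiagram | μ.IsTCore t ∧ μ.card = n}.ncard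

theorem YoungDiagram.colLen_le_card (μ : YoungDiagram) (j : ℕ) : μ.colLen j ≤ μ.card := by
  rw [colLen_eq_card]
  exact Finset.card_filter_le _ _

/-- The `t`-cores of size `d` are counted by the arrangements of `N ≥ d` beads on an abacus. -/
theorem coreCount_eq_ncard (ht : 0 < t) {N d : ℕ} (hN : d ≤ N) :
    coreCount t d = {c : Fin t → ℕ | ∑ r, c r = N ∧ abacusWeight c = N.choose 2 + d}.ncard := by
  set A := {μ : YoungDiagram | μ.IsTCore t ∧ μ.card = d} with hA
  set B := {c : Fin t → ℕ | ∑ r, c r = N ∧ abacusWeight c = N.choose 2 + d} with hB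
  have hcol : ∀ μ ∈ A, μ.colLen 0 ≤ N := fun μ hμ =>
    (μ.colLen_le_card 0).trans (hμ.2.le.trans hN)
  have himage : (fun μ : YoungDiagram => μ.betaSet N) '' A = abacus '' B := by
    apply Set.Subset.antisymm
    · rintro _ ⟨μ, hμ, rfl⟩
      obtain ⟨c, hc⟩ :=
        exists_abacus_eq ht ((YoungDiagram.isTCore_iff_betaSet ht (hcol μ hμ)).1 hμ.1)
      refine ⟨c, ⟨?_, ?_⟩, hc⟩
      · rw [← card_abacus, hc, μ.card_betaSet]
      · rw [← sum_id_abacus, hc, YoungDiagram.sum_betaSet (hcol μ hμ), hμ.2]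
    · rintro _ ⟨c, hc, rfl⟩
      obtain ⟨μ, hμ, h⟩ := YoungDiagram.exists_betaSet_eq ((card_abacus c).trans hc.1)
      refine ⟨μ, ⟨?_, ?_⟩, h⟩
      · rw [YoungDiagram.isTCore_iff_betaSet ht hμ, h]
        exact fun x => sub_mem_abacus
      · have := YoungDiagram.sum_betaSet hμ
        rw [h, sum_id_abacus, hc.2] at this
        omega
  have h1 : Set.InjOn (fun μ : YoungDiagram => μ.betaSet N) A := fun μ hμ ν hν h =>
    YoungDiagram.betaSet_inj (hcol μ hμ) (hcol ν hν) h
  rw [coreCount, ← h1.ncard_image, himage,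
    Set.ncard_image_of_injective _ abacus_injective]

/-- A balanced arrangement of `t * M` beads has minimal weight, and the weight bounds the
deviation from it. -/
theorem abs_sub_le_abacusWeight {M : ℕ} {c : Fin t → ℕ} (hc : ∑ r, c r = t * M) :
    ∑ r, |(c r : ℤ) - M| ≤ 2 * ((abacusWeight c : ℤ) - (t * M).choose 2) := by
  have h1 : 2 * (abacusWeight c : ℤ) =
      ∑ r : Fin t, (2 * (r : ℤ) * c r + t * (c r * ((c r : ℤ) - 1))) := by
    rw [abacusWeight]
    push_cast
    rw [Finset.mul_sum]
    refine Finset.sum_congr rfl fun r _ => ?_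
    rw [← two_mul_choose_two_cast]
    ring
  have h2 := two_mul_choose_two_cast (t * M)
  have h3 : ∑ r : Fin t, 2 * (r : ℤ) = t * (t - 1) := by
    rw [← two_mul_choose_two_cast, Nat.choose_two_right, ← Finset.sum_range_id, ← Finset.mul_sum,
      Finset.sum_range]
    push_cast
    rfl
  have h4 : ∑ r, ((c r : ℤ) - M) = 0 := by
    rw [Finset.sum_sub_distrib]
    have := congrArg (fun n : ℕ => (n : ℤ)) hc
    push_cast at this
    rw [this]
    simp
  have h5 : 2 * ((abacusWeight c : ℤ) - (t * M).choose 2) =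
      ∑ r : Fin t, (t * ((c r : ℤ) - M) ^ 2 + (2 * (r : ℤ) - t + 1) * ((c r : ℤ) - M)) := by
    have e : ∀ r : Fin t, 2 * (r : ℤ) * c r + t * (c r * ((c r : ℤ) - 1)) =
        (t * ((c r : ℤ) - M) ^ 2 + (2 * (r : ℤ) - t + 1) * ((c r : ℤ) - M)) +
          (M * (2 * (r : ℤ)) + (t * M ^ 2 - t * M) + (2 * t * M - 1) * ((c r : ℤ) - M)) := by
      intro r
      ring
    have e' : ∑ r : Fin t, ((M : ℤ) * (2 * (r : ℤ)) + (t * M ^ 2 - t * M) +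
        (2 * t * M - 1) * ((c r : ℤ) - M)) = (t * M * (t * M - 1) : ℤ) := by
      rw [Finset.sum_add_distrib, Finset.sum_add_distrib, ← Finset.mul_sum, h3,
        ← Finset.mul_sum, h4, Finset.sum_const, Finset.card_univ, Fintype.card_fin, nsmul_eq_mul]
      ring
    rw [mul_sub, h1, h2, Finset.sum_congr rfl fun r _ => e r, Finset.sum_add_distrib, e']
    push_cast
    ring
  rw [h5]
  refine Finset.sum_le_sum fun r _ => ?_
  generalize (c r : ℤ) - M = m
  have hr : (r : ℤ) + 1 ≤ t := by exact_mod_cast r.isLt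
  have hr0 : (0 : ℤ) ≤ r := by positivity
  have hm : |m| ≤ |m| ^ 2 := by
    rcases eq_or_ne m 0 with rfl | h
    · simp
    · have := Int.one_le_abs h
      nlinarith
  have h6 : -(((t : ℤ) - 1) * |m|) ≤ (2 * (r : ℤ) - t + 1) * m := by
    have h7 : |(2 * (r : ℤ) - t + 1) * m| ≤ (t - 1) * |m| := by
      rw [abs_mul]
      exact mul_le_mul_of_nonneg_right (abs_le.2 ⟨by linarith, by linarith⟩) (abs_nonneg m)
    have := neg_abs_le ((2 * (r : ℤ) - t + 1) * m)
    linarith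
  rw [← sq_abs]
  nlinarith

end Abacus

/-! ### The generating series of the cores -/

section CoreSeries

/-- The generating series of the `t`-cores by size. -/
noncomputable def coreSeries (t : ℕ) : ℤ⟦X⟧ := mk fun n => (coreCount t n : ℤ)

/-- The generating series of the `t`-cores is `∏ (1 - X ^ (t n)) ^ t / (1 - X ^ n)`. -/
theorem coreSeries_mul_pentagonalSeries {t : ℕ} (ht : t ≠ 0) :
    coreSeries t * pentagonalSeries ℤ = expand t ht (pentagonalSeries ℤ) ^ t := by
  rw [← sub_eq_zero]
  ext d
  rw [map_zero]
  refine X_pow_dvd_iff.1 (?_ : (X : ℤ⟦X⟧) ^ (d + 1) ∣ _) d (Nat.lt_succ_self d)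
  have ht0 : 0 < t := Nat.pos_of_ne_zero ht
  -- with `3 d` beads per runner on average, weights of excess at most `d` have at least `d` beads
  -- and at least `d` free positions among the first `6 d` on each runner
  obtain ⟨M, hM⟩ : ∃ M, M = 3 * d := ⟨_, rfl⟩
  have hNd : d ≤ t * M := by nlinarith
  set S := (Fintype.piFinset fun _ : Fin t => Finset.range (2 * M + 1)).filter
    fun c => ∑ r, c r = t * M with hS
  have habs : ∀ c : Fin t → ℕ, ∑ r, c r = t * M → ∀ r,
      |(c r : ℤ) - M| ≤ 2 * ((abacusWeight c : ℤ) - (t * M).choose 2) := fun c hc r =>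
    (Finset.single_le_sum (f := fun r => |(c r : ℤ) - M|) (fun _ _ => abs_nonneg _)
      (Finset.mem_univ r)).trans (abs_sub_le_abacusWeight hc)
  have hle : ∀ c : Fin t → ℕ, ∑ r, c r = t * M → (t * M).choose 2 ≤ abacusWeight c := by
    intro c hc
    have := habs c hc ⟨0, ht0⟩
    have := abs_nonneg ((c ⟨0, ht0⟩ : ℤ) - M)
    omega
  have hdev : ∀ c : Fin t → ℕ, ∑ r, c r = t * M → abacusWeight c - (t * M).choose 2 ≤ d →
      ∀ r, d ≤ c r ∧ d + c r ≤ 2 * M := by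
    intro c hc hd r
    have h1 := abs_le.1 (habs c hc r)
    have h2 := hle c hc
    omega
  have hQ : qBinom (X : ℤ⟦X⟧) (t * M + t * M) (t * M) =
      ∑ c ∈ S, X ^ (abacusWeight c - (t * M).choose 2) * ∏ r, qBinom (X ^ t) (2 * M) (c r) := by
    have h1 := qBinom_mul_eq_sum (X : ℤ⟦X⟧) t (2 * M) (t * M)
    refine mul_left_cancel₀ (pow_ne_zero ((t * M).choose 2) X_ne_zero) ?_
    rw [show t * M + t * M = t * (2 * M) by ring, h1, Finset.mul_sum]
    refine Finset.sum_congr rfl fun c hc => ?_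
    rw [← mul_assoc, ← pow_add, Nat.add_sub_cancel' (hle c (Finset.mem_filter.1 hc).2)]
    rfl
  set Q := qBinom (X : ℤ⟦X⟧) (t * M + t * M) (t * M)
  set E' := expand t ht (pentagonalSeries ℤ)
  have h2 : (X : ℤ⟦X⟧) ^ (d + 1) ∣ Q * pentagonalSeries ℤ - 1 :=
    X_pow_dvd_qBinom_mul_pentagonalSeries_sub_one hNd hNd
  have h3 : (X : ℤ⟦X⟧) ^ (d + 1) ∣
      E' ^ t * Q - ∑ c ∈ S, X ^ (abacusWeight c - (t * M).choose 2) := by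
    rw [hQ, Finset.mul_sum, ← Finset.sum_sub_distrib]
    refine Finset.dvd_sum fun c hc => ?_
    have hc := (Finset.mem_filter.1 hc).2
    have e : E' ^ t * (X ^ (abacusWeight c - (t * M).choose 2) *
          ∏ r, qBinom (X ^ t) (2 * M) (c r)) - X ^ (abacusWeight c - (t * M).choose 2) =
        X ^ (abacusWeight c - (t * M).choose 2) *
          (∏ r, (qBinom (X ^ t) (2 * M) (c r) * E') - ∏ _r : Fin t, 1) := by
      rw [Finset.prod_mul_distrib, Finset.prod_const, Finset.prod_const_one, Finset.card_univ,
        Fintype.card_fin]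
      ring
    rw [e]
    by_cases hd : abacusWeight c - (t * M).choose 2 ≤ d
    · refine Dvd.dvd.mul_left (dvd_prod_sub_prod _ fun r _ => ?_) _
      obtain ⟨h4, h5⟩ := hdev c hc hd r
      have h6 := X_pow_dvd_qBinom_mul_pentagonalSeries_sub_one (R := ℤ) (k := c r)
        (l := 2 * M - c r) h4 (by omega)
      rw [Nat.add_sub_cancel' (by omega)] at h6
      have h7 := X_pow_dvd_expand ht h6
      have h8 := map_qBinom (expand t ht : ℤ⟦X⟧ →ₐ[ℤ] ℤ⟦X⟧).toRingHom X (2 * M) (c r)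
      simp only [AlgHom.toRingHom_eq_coe, RingHom.coe_coe, expand_X] at h8
      rwa [map_sub, map_mul, map_one, h8] at h7
    · exact (pow_dvd_pow _ (by omega)).mul_right _
  have h4 : (X : ℤ⟦X⟧) ^ (d + 1) ∣
      coreSeries t - ∑ c ∈ S, X ^ (abacusWeight c - (t * M).choose 2) := by
    rw [X_pow_dvd_iff]
    intro e he
    rw [map_sub, sub_eq_zero, coreSeries, coeff_mk, map_sum,
      coreCount_eq_ncard ht0 (show e ≤ t * M by omega)]
    simp only [coeff_X_pow]
    rw [Finset.sum_boole, Nat.cast_inj, ← Set.ncard_coe_finset]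
    congr 1
    ext c
    simp only [Set.mem_ofPred_eq, Finset.coe_filter, hS, Finset.mem_filter, Fintype.mem_piFinset,
      Finset.mem_range]
    constructor
    · rintro ⟨h5, h6⟩
      have h7 := hdev c h5 (by omega)
      exact ⟨⟨fun r => by have := h7 r; omega, h5⟩, by omega⟩
    · rintro ⟨⟨-, h5⟩, h6⟩
      have := hle c h5
      exact ⟨h5, by omega⟩
  obtain ⟨a, ha⟩ := h2
  obtain ⟨b, hb⟩ := h3
  obtain ⟨c, hc⟩ := h4
  refine ⟨c * pentagonalSeries ℤ - b * pentagonalSeries ℤ + E' ^ t * a, ?_⟩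
  linear_combination pentagonalSeries ℤ * hc - pentagonalSeries ℤ * hb + E' ^ t * ha

end CoreSeries

/-! ### Tuples of cores -/

section Counting

theorem finite_cores (t n : ℕ) : {μ : YoungDiagram | μ.IsTCore t ∧ μ.card ≤ n}.Finite := by
  refine ((Set.finite_Iic n).biUnion fun d _ =>
    (coreTuples_finite t 1 d).image fun Λ => Λ 0).subset ?_
  rintro μ ⟨h1, h2⟩
  exact Set.mem_biUnion h2 ⟨fun _ => μ, ⟨fun _ => h1, by simp⟩, rfl⟩

theorem coreTupleCount_eq_coeff (t k n : ℕ) :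
    (coreTupleCount t k n : ℤ) = coeff n (coreSeries t ^ k) := by
  classical
  set S := (finite_cores t n).toFinset with hS
  set P : ℤ⟦X⟧ := ∑ μ ∈ S, X ^ μ.card with hP
  have h1 : (X : ℤ⟦X⟧) ^ (n + 1) ∣ coreSeries t - P := by
    rw [X_pow_dvd_iff]
    intro e he
    rw [map_sub, sub_eq_zero, coreSeries, coeff_mk, hP, map_sum]
    simp only [coeff_X_pow]
    rw [Finset.sum_boole, Nat.cast_inj, coreCount, ← Set.ncard_coe_finset]
    congr 1
    ext μ
    simp only [Set.mem_ofPred_eq, Finset.coe_filter, hS, Set.Finite.mem_toFinset]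
    constructor
    · rintro ⟨h1, h2⟩
      exact ⟨⟨h1, by omega⟩, h2.symm⟩
    · rintro ⟨⟨h1, -⟩, h2⟩
      exact ⟨h1, h2.symm⟩
  have h2 := X_pow_dvd_iff.1 (h1.trans (sub_dvd_pow_sub_pow _ _ k)) n (Nat.lt_succ_self n)
  rw [map_sub, sub_eq_zero] at h2
  have h3 : P ^ k = ∑ Λ ∈ Fintype.piFinset fun _ : Fin k => S, X ^ ∑ m, (Λ m).card := by
    have h4 : P ^ k = ∏ _m : Fin k, P := by simp
    rw [h4, hP, Finset.prod_univ_sum]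
    exact Finset.sum_congr rfl fun Λ _ => Finset.prod_pow_eq_pow_sum _ _ _
  rw [h2, h3, map_sum]
  simp only [coeff_X_pow]
  rw [Finset.sum_boole, Nat.cast_inj, coreTupleCount, ← Set.ncard_coe_finset]
  congr 1
  ext Λ
  simp only [coreTuples, Set.mem_ofPred_eq, Finset.coe_filter, Fintype.mem_piFinset, hS,
    Set.Finite.mem_toFinset]
  constructor
  · rintro ⟨h4, h5⟩
    refine ⟨fun m => ⟨h4 m, ?_⟩, h5.symm⟩
    rw [← h5]
    exact Finset.single_le_sum (f := fun m => (Λ m).card) (fun _ _ => Nat.zero_le _)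
      (Finset.mem_univ m)
  · rintro ⟨h4, h5⟩
    exact ⟨fun m => (h4 m).1, h5.symm⟩

end Counting

/-! ### Lifting congruences between powers of a series -/

section Frobenius

theorem intCast_dvd_iff_coeff (d : ℤ) (f : ℤ⟦X⟧) : (d : ℤ⟦X⟧) ∣ f ↔ ∀ n, d ∣ coeff n f := by
  constructor
  · rintro ⟨g, rfl⟩ n
    rw [← zsmul_eq_mul, map_zsmul, smul_eq_mul]
    exact dvd_mul_right _ _
  · intro h
    choose g hg using h
    refine ⟨mk g, ?_⟩
    ext n
    rw [← zsmul_eq_mul, map_zsmul, smul_eq_mul, coeff_mk, hg]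

theorem five_dvd_pow_sub_expand (f : ℤ⟦X⟧) : 5 ∣ f ^ 5 - expand 5 (by norm_num) f := by
  have : Fact (Nat.Prime 5) := ⟨Nat.prime_five⟩
  have h1 : map (Int.castRingHom (ZMod 5)) (f ^ 5 - expand 5 (by norm_num) f) = 0 := by
    have h2 := MvPowerSeries.map_frobenius_expand (p := 5) (by norm_num)
      (f := map (Int.castRingHom (ZMod 5)) f)
    rw [ZMod.frobenius_zmod, MvPowerSeries.map_id] at h2
    rw [map_sub, map_pow, map_expand, sub_eq_zero]
    exact h2.symm
  rw [← show ((5 : ℤ) : ℤ⟦X⟧) = 5 by norm_num, intCast_dvd_iff_coeff]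
  intro n
  refine (ZMod.intCast_zmod_eq_zero_iff_dvd _ 5).1 ?_
  have h2 := congrArg (coeff n) h1
  rwa [coeff_map, map_zero] at h2

theorem five_dvd_pow_five_pow_sub_expand (f : ℤ⟦X⟧) (b : ℕ) :
    5 ∣ f ^ 5 ^ b - expand (5 ^ b) (by positivity) f := by
  induction b generalizing f with
  | zero => simp
  | succ b ih =>
    have h1 : expand (5 ^ (b + 1)) (by positivity) f =
        expand (5 ^ b) (by positivity) (expand 5 (by norm_num) f) := expand_mul _ _ _ _ f
    rw [h1, pow_succ', pow_mul]
    have h2 := ih (expand 5 (by norm_num) f)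
    have h3 := (five_dvd_pow_sub_expand f).trans
      (sub_dvd_pow_sub_pow (f ^ 5) (expand 5 (by norm_num) f) (5 ^ b))
    simpa using dvd_add h3 h2

theorem five_pow_dvd_pow_sub_expand (f : ℤ⟦X⟧) (b c : ℕ) :
    ((5 ^ (c + 1) : ℤ) : ℤ⟦X⟧) ∣ f ^ 5 ^ (b + c) - expand (5 ^ b) (by positivity) (f ^ 5 ^ c) := by
  have h := dvd_sub_pow_of_dvd_sub (p := 5)
    (by exact_mod_cast five_dvd_pow_five_pow_sub_expand f b) c
  rw [map_pow, pow_add 5 b c, pow_mul f]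
  push_cast at h ⊢
  exact h

theorem dvd_coeff_expand_mul {d : ℤ} {q r : ℕ} (hq : q ≠ 0) (hr : r < q) {g : ℤ⟦X⟧}
    (hg : ∀ n, d ∣ coeff (q * n + r) g) (f : ℤ⟦X⟧) (n : ℕ) :
    d ∣ coeff (q * n + r) (expand q hq f * g) := by
  rw [coeff_mul]
  refine Finset.dvd_sum fun p hp => ?_
  rw [Finset.HasAntidiagonal.mem_antidiagonal] at hp
  by_cases h : q ∣ p.1
  · obtain ⟨j, hj⟩ := h
    have hjn : j ≤ n := by
      by_contra h'
      have : q * (n + 1) ≤ q * j := Nat.mul_le_mul_left q (by omega)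
      rw [Nat.mul_succ] at this
      omega
    obtain ⟨m, rfl⟩ := Nat.exists_eq_add_of_le hjn
    have : p.2 = q * m + r := by rw [Nat.mul_add] at hp; omega
    rw [this]
    exact (hg m).mul_left _
  · rw [coeff_expand_of_not_dvd _ _ _ h, zero_mul]
    exact dvd_zero _

/-- A congruence modulo `5 ^ (c + 1)` for the coefficients of `G ^ k` in a residue class modulo
`5 ^ b` persists when `k` is increased by a multiple of `5 ^ (b + c)`, since then `G ^ k` changes by
a factor that is a series in `X ^ (5 ^ b)` modulo `5 ^ (c + 1)`. -/
theorem five_pow_dvd_coeff_pow {b c k r : ℕ} (hr : r < 5 ^ b) {G : ℤ⟦X⟧}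
    (h : ∀ n, (5 ^ (c + 1) : ℤ) ∣ coeff (5 ^ b * n + r) (G ^ k)) (i n : ℕ) :
    (5 ^ (c + 1) : ℤ) ∣ coeff (5 ^ b * n + r) (G ^ (5 ^ (b + c) * i + k)) := by
  have h1 := (five_pow_dvd_pow_sub_expand (G ^ i) b c).mul_right (G ^ k)
  rw [sub_mul, intCast_dvd_iff_coeff] at h1
  have h2 := h1 (5 ^ b * n + r)
  rw [map_sub] at h2
  have h3 := dvd_coeff_expand_mul (by positivity) hr h ((G ^ i) ^ 5 ^ c) n
  rw [pow_add G, mul_comm _ i, pow_mul G i]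
  exact (dvd_iff_dvd_of_dvd_sub h2).2 h3

end Frobenius

/-! ### The congruences -/

section Congruences

theorem X_mul_coreSeries_five : X * coreSeries 5 = eisF := by
  have h := coreSeries_mul_pentagonalSeries (show (5 : ℕ) ≠ 0 by norm_num)
  rw [eisF, ← h]
  linear_combination (-X * coreSeries 5) * pentagonalSeries_mul_eulerInv

theorem coeff_coreSeries_five_pow (k m : ℕ) :
    coeff m (coreSeries 5 ^ k) = coeff (m + k) (eisF ^ k) := by
  rw [← X_mul_coreSeries_five, mul_pow, coeff_X_pow_mul]

theorem dvd_coeff_of_dvd_uFive_uFive {d : ℤ} {k : ℕ} {r : ℕ} (hr : r + k = 25)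
    (h : (d : ℤ⟦X⟧) ∣ uFive (uFive (eisF ^ k))) (n : ℕ) :
    d ∣ coeff (25 * n + r) (coreSeries 5 ^ k) := by
  have := (intCast_dvd_iff_coeff d _).1 h (n + 1)
  rw [coeff_uFive, coeff_uFive] at this
  rwa [coeff_coreSeries_five_pow, show 25 * n + r + k = 5 * (5 * (n + 1)) by omega]

theorem dvd_coeff_of_dvd_uFive_uFive_uFive {d : ℤ} {k : ℕ} {r : ℕ} (hr : r + k = 125)
    (h : (d : ℤ⟦X⟧) ∣ uFive (uFive (uFive (eisF ^ k)))) (n : ℕ) :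
    d ∣ coeff (125 * n + r) (coreSeries 5 ^ k) := by
  have := (intCast_dvd_iff_coeff d _).1 h (n + 1)
  rw [coeff_uFive, coeff_uFive, coeff_uFive] at this
  rwa [coeff_coreSeries_five_pow, show 125 * n + r + k = 5 * (5 * (5 * (n + 1))) by omega]

/-- Modulo `5` the fourth power of the generating series of the `5`-cores is the Euler product times
a series in `X ^ 5`, and the pentagonal numbers are not congruent to `3` or `4` modulo `5`. -/
theorem five_dvd_coeff_coreSeries_five_pow_four {r : ℕ} (hr : r = 3 ∨ r = 4) (n : ℕ) :
    5 ∣ coeff (5 * n + r) (coreSeries 5 ^ 4) := by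
  set E := pentagonalSeries ℤ with hE
  set E' := expand 5 (by norm_num) E
  have h1 := coreSeries_mul_pentagonalSeries (show (5 : ℕ) ≠ 0 by norm_num)
  have h2 : E' * expand 5 (by norm_num) eulerInv = 1 := expand_pentagonalSeries_mul_eulerInv
  obtain ⟨a, ha⟩ := five_dvd_pow_sub_expand E
  have h3 : ((5 : ℤ) : ℤ⟦X⟧) ∣ coreSeries 5 ^ 4 - expand 5 (by norm_num) (E ^ 19) * E := by
    refine ⟨-(expand 5 (by norm_num) eulerInv * coreSeries 5 ^ 4 * a), ?_⟩
    have h4 : coreSeries 5 ^ 4 * E ^ 5 = E' ^ 20 * E := by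
      calc coreSeries 5 ^ 4 * E ^ 5 = (coreSeries 5 * E) ^ 4 * E := by ring
        _ = _ := by rw [h1]; ring
    rw [map_pow]
    push_cast
    linear_combination expand 5 (by norm_num) eulerInv * (h4 - coreSeries 5 ^ 4 * ha) -
      (coreSeries 5 ^ 4 - E' ^ 19 * E) * h2
  have h4 : ∀ m, (5 : ℤ) ∣ coeff (5 * m + r) E := by
    intro m
    rw [hE, coeff_pentagonalSeries_eq_zero]
    · exact dvd_zero _
    · rintro ⟨k, hk⟩
      rcases pentagonal_mod_five k with h | h | h <;> omega
  have h5 := (intCast_dvd_iff_coeff 5 _).1 h3 (5 * n + r)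
  rw [map_sub] at h5
  exact (dvd_iff_dvd_of_dvd_sub h5).2
    (dvd_coeff_expand_mul (by norm_num) (by omega) h4 (E ^ 19) n)

theorem coreTupleCount_modEq_zero {b c k r : ℕ} (hr : r < 5 ^ b)
    (h : ∀ n, (5 ^ (c + 1) : ℤ) ∣ coeff (5 ^ b * n + r) (coreSeries 5 ^ k)) (i n : ℕ) :
    coreTupleCount 5 (5 ^ (b + c) * i + k) (5 ^ b * n + r) ≡ 0 [MOD 5 ^ (c + 1)] := by
  rw [Nat.modEq_zero_iff_dvd]
  have := five_pow_dvd_coeff_pow hr h i n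
  rw [← coreTupleCount_eq_coeff] at this
  exact_mod_cast this

end Congruences

theorem mainTheorem7 (i n : ℕ) :
    coreTupleCount 5 (25 * i + 2) (25 * n + 23) ≡ 0 [MOD 5] ∧
    coreTupleCount 5 (125 * i + 2) (25 * n + 23) ≡ 0 [MOD 25] ∧
    coreTupleCount 5 (3125 * i + 2) (125 * n + 123) ≡ 0 [MOD 125] ∧
    coreTupleCount 5 (25 * i + 3) (25 * n + 22) ≡ 0 [MOD 5] ∧
    coreTupleCount 5 (625 * i + 3) (125 * n + 122) ≡ 0 [MOD 25] ∧
    coreTupleCount 5 (5 * i + 4) (5 * n + 3) ≡ 0 [MOD 5] ∧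
    coreTupleCount 5 (5 * i + 4) (5 * n + 4) ≡ 0 [MOD 5] ∧
    coreTupleCount 5 (25 * i + 4) (25 * n + 21) ≡ 0 [MOD 5] ∧
    coreTupleCount 5 (125 * i + 4) (25 * n + 21) ≡ 0 [MOD 25] ∧
    coreTupleCount 5 (625 * i + 4) (25 * n + 21) ≡ 0 [MOD 125] ∧
    coreTupleCount 5 (3125 * i + 4) (25 * n + 21) ≡ 0 [MOD 625] ∧
    coreTupleCount 5 (15625 * i + 4) (25 * n + 21) ≡ 0 [MOD 3125] ∧
    coreTupleCount 5 (390625 * i + 4) (125 * n + 121) ≡ 0 [MOD 15625] := by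
  have h2 : ∀ n, (25 : ℤ) ∣ coeff (25 * n + 23) (coreSeries 5 ^ 2) :=
    dvd_coeff_of_dvd_uFive_uFive rfl ⟨_, by push_cast; exact uFive_uFive_eisF_pow_2⟩
  have h2' : ∀ n, (125 : ℤ) ∣ coeff (125 * n + 123) (coreSeries 5 ^ 2) :=
    dvd_coeff_of_dvd_uFive_uFive_uFive rfl ⟨_, by push_cast; exact uFive_uFive_uFive_eisF_pow_2⟩
  have h3 : ∀ n, (5 : ℤ) ∣ coeff (25 * n + 22) (coreSeries 5 ^ 3) :=
    dvd_coeff_of_dvd_uFive_uFive rfl ⟨_, by push_cast; exact uFive_uFive_eisF_pow_3⟩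
  have h3' : ∀ n, (25 : ℤ) ∣ coeff (125 * n + 122) (coreSeries 5 ^ 3) :=
    dvd_coeff_of_dvd_uFive_uFive_uFive rfl ⟨_, by push_cast; exact uFive_uFive_uFive_eisF_pow_3⟩
  have h4 : ∀ n, (3125 : ℤ) ∣ coeff (25 * n + 21) (coreSeries 5 ^ 4) :=
    dvd_coeff_of_dvd_uFive_uFive rfl ⟨_, by push_cast; exact uFive_uFive_eisF_pow_4⟩
  have h4' : ∀ n, (15625 : ℤ) ∣ coeff (125 * n + 121) (coreSeries 5 ^ 4) :=
    dvd_coeff_of_dvd_uFive_uFive_uFive rfl ⟨_, by push_cast; exact uFive_uFive_uFive_eisF_pow_4⟩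
  have h43 := five_dvd_coeff_coreSeries_five_pow_four (Or.inl rfl)
  have h44 := five_dvd_coeff_coreSeries_five_pow_four (Or.inr rfl)
  refine ⟨?_, ?_, ?_, ?_, ?_, ?_, ?_, ?_, ?_, ?_, ?_, ?_, ?_⟩
  · exact coreTupleCount_modEq_zero (b := 2) (c := 0) (by norm_num)
      (fun n => (by norm_num : (5 ^ 1 : ℤ) ∣ 25).trans (h2 n)) i n
  · exact coreTupleCount_modEq_zero (b := 2) (c := 1) (by norm_num) h2 i n
  · exact coreTupleCount_modEq_zero (b := 3) (c := 2) (by norm_num) h2' i n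
  · exact coreTupleCount_modEq_zero (b := 2) (c := 0) (by norm_num) h3 i n
  · exact coreTupleCount_modEq_zero (b := 3) (c := 1) (by norm_num) h3' i n
  · exact coreTupleCount_modEq_zero (b := 1) (c := 0) (by norm_num) h43 i n
  · exact coreTupleCount_modEq_zero (b := 1) (c := 0) (by norm_num) h44 i n
  · exact coreTupleCount_modEq_zero (b := 2) (c := 0) (by norm_num)
      (fun n => (by norm_num : (5 ^ 1 : ℤ) ∣ 3125).trans (h4 n)) i n
  · exact coreTupleCount_modEq_zero (b := 2) (c := 1) (by norm_num)
      (fun n => (by norm_num : (5 ^ 2 : ℤ) ∣ 3125).trans (h4 n)) i n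
  · exact coreTupleCount_modEq_zero (b := 2) (c := 2) (by norm_num)
      (fun n => (by norm_num : (5 ^ 3 : ℤ) ∣ 3125).trans (h4 n)) i n
  · exact coreTupleCount_modEq_zero (b := 2) (c := 3) (by norm_num)
      (fun n => (by norm_num : (5 ^ 4 : ℤ) ∣ 3125).trans (h4 n)) i n
  · exact coreTupleCount_modEq_zero (b := 2) (c := 4) (by norm_num) h4 i n
  · exact coreTupleCount_modEq_zero (b := 3) (c := 5) (by norm_num) h4' i n
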